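/- **Setting.** Fix a finite state space $\mathcal S$ and finite nonempty action sets $\mathcal A(s)$, and let $\mathcal X=\{(s,a):s\in\mathcal S,\ a\in\mathcal A(s)\}$ be the set of pairs. A model $M$ consists of transition laws $p(\cdot\mid x)$ on $\mathcal S$ and reward laws $q(x)$ on $[0,1]$, $x\in\mathcal X$; let $\mathcal M$ be an arbitrary set of models on $\mathcal X$. A learning agent $\Lambda$ chooses, at each step, a random action available in the current state as a (measurable) function of the past. Let $X_t=(S_t,A_t)$ and $R_t$, $t\ge 0$, be the pairs played and rewards received from $S_0=s_0$, with expectation $\mathbb E^{M,\Lambda}_{s_0}$, and let $N_T(x)=\#\{0\le t<T: X_t=x\}$. For a stationary randomized policy $\pi$, let $g_\pi(s;M)=\lim_{T}\frac1T\mathbb E^{M,\pi}_{s}[\sum_{t<T}R_t]$, let $g^*(s;M)=\sup_\pi g_\pi(s;M)$, and let $\Pi^*(M)$ be the set of gain-optimal policies, i.e. those with $g_\pi(\cdot;M)=g^*(\cdot;M)$. The set $\mathcal X^*(M)$ of optimal pairs is the union over $\pi\in\Pi^*(M)$ of the sets of recurrent pairs of $\pi$, that is, of the pairs $(s,a)$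 with $\pi(a\mid s)>0$ and $s$ recurrent for the Markov chain of $\pi$ in $M$. The agent $\Lambda$ is *consistent* on $\mathcal M$ if $T g^*(s_0;M)-\mathbb E^{M,\Lambda}_{s_0}[\sum_{t<T}R_t]=o(T^\eta)$ as $T\to\infty$ for all $M\in\mathcal M$, $s_0\in\mathcal S$ and $\eta>0$. The *confusing set* $\mathrm{Conf}(M)$ is the set of $M^\dagger\in\mathcal M$ such that the transition and reward laws of $M$ are absolutely continuous with respect to those of $M^\dagger$ at every pair, $M^\dagger=M$ on $\mathcal X^*(M)$, and $\Pi^*(M^\dagger)\cap\Pi^*(M)=\emptyset$. The *contraction* $M/\mathcal X^*(M)$ is the model obtained from $M$ by merging each communicating component of $\mathcal X^*(M)$ into a single state: $s$ and $s'$ are merged if $s=s'$ or if each can be reached from the other by playing only pairs of $\mathcal X^*(M)$; the pairs, rewards and transitions are inherited, so that its pair space is identified with $\mathcal X$ and $[p]([s']\mid x)=\sum_{s''\in[s']}p(s''\mid x)$. Its set of invariant measures $\mathcal I(M/\mathcal X^*(M))$ consists of the $\mu\in[0,\infty)^{\mathcal X}$ such that, for every merged state $[s]$, $\sum_{s'\in[s]}\sum_{a\in\mathcal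 A(s')}\mu(s',a)=\sum_{x\in\mathcal X}\mu(x)\,[p]([s]\mid x)$. Let $\mathcal P(\mathcal X)$ be the set of probability vectors on $\mathcal X$. **Corollary (Navigation constraints).** Let $\Lambda$ be consistent on $\mathcal M$, let $M\in\mathcal M$ be communicating (every state can be reached from every other) with $\mathrm{Conf}(M)\neq\emptyset$, and let $s_0\in\mathcal S$ be any initial state. Then $\mathbb E^{M,\Lambda}_{s_0}\big[\sum_{x'\notin\mathcal X^*(M)}N_T(x')\big]>0$ for all large $T$, and the vector $$\mu_T(x)=\frac{\mathbb E^{M,\Lambda}_{s_0}[N_T(x)]\,\mathbf 1\{x\notin\mathcal X^*(M)\}}{\mathbb E^{M,\Lambda}_{s_0}\big[\sum_{x'\notin\mathcal X^*(M)}N_T(x')\big]}$$ converges to the set $\mathcal I(M/\mathcal X^*(M))\cap\mathcal P(\mathcal X)$ as $T\to\infty$: this set is nonempty, the distance from $\mu_T$ to it tends to $0$, and every limit point of $(\mu_T)$ belongs to it. -/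

import Mathlib

open MeasureTheory ProbabilityTheory Filter Topology
open scoped ENNReal unitInterval

noncomputable section

universe u v

namespace NavMDP

/-! ### Markov decision processes on a fixed finite pair space -/

/-- The state-action pairs `(s, a)` with `a` an action available in the state `s`. -/
def Pair {S : Type u} (A : S → Type v) : Type (max u v) := Σ s, A s

variable {S : Type u} [Fintype S] {A : S → Type v} [∀ s, Fintype (A s)]

instance : Fintype (Pair A) := by classical exact inferInstanceAs (Fintype (Σ s, A s))

instance {S : Type u} {A : S → Type v} : MeasurableSpace (Pair A) := ⊤

instance {S : Type u} {A : S → Type v} : DiscreteMeasurableSpace (Pair A) := ⟨fun _ => trivial⟩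

/-- A Markov decision process with pair space `Pair A`: a transition kernel and, for every pair,
a reward distribution on `[0, 1]`. -/
structure MDP {S : Type u} (A : S → Type v) where
  /-- `trans x s'` is the probability `p(s' | x)`. -/
  trans : Pair A → PMF S
  /-- The reward distribution of a pair. -/
  rew : Pair A → ProbabilityMeasure I

/-- One step of interaction: the pair that is played and the reward that is received. -/
abbrev Obs {S : Type u} (A : S → Type v) : Type (max u v) := Pair A × I

/-- A learning agent: given the first `t` steps of the interaction and the current state,
a probability distribution on the available actions, measurable in the history. -/
structure Learner {S : Type u} (A : S → Type v) where
  act : ∀ t : ℕ, (Fin t → Obs A) → ∀ s, PMF (A s)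
  measurable_act : ∀ t s a, Measurable fun h => act t h s a

/-- A (randomized) stationary policy. -/
def Policy {S : Type u} (A : S → Type v) : Type (max u v) := ∀ s, PMF (A s)

/-- The agent that follows a stationary policy. -/
def Policy.toLearner {S : Type u} {A : S → Type v} (π : Policy A) : Learner A where
  act _ _ s := π s
  measurable_act _ _ _ := measurable_const

/-! ### The law of the interaction -/

/-- The law of the current state after a history of `t` steps; `s₀` is the initial state. -/
def stateLaw {S : Type u} {A : S → Type v} (M : MDP A) (s₀ : S) :
    ∀ t : ℕ, (Fin t → Obs A) → PMF S
  | 0, _ => PMF.pure s₀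
  | t + 1, h => M.trans (h (Fin.last t)).1

lemma measurable_stateLaw {S : Type u} {A : S → Type v} (M : MDP A) (s₀ : S) (t : ℕ) (s : S) :
    Measurable fun h : Fin t → Obs A => stateLaw M s₀ t h s := by
  cases t with
  | zero => exact measurable_const
  | succ t =>
    have h1 : Measurable fun x : Pair A => M.trans x s := measurable_from_top
    exact h1.comp (measurable_fst.comp (measurable_pi_apply (Fin.last t)))

/-- The law of the next step given the history: the state is drawn from the last transition (or is
the initial state), the action is drawn by the agent and the reward is drawn from the reward
distribution of the resulting pair. -/
def stepKernel (M : MDP A) (Λ : Learner A) (s₀ : S) (t : ℕ) :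
    Kernel (Fin t → Obs A) (Obs A) where
  toFun h := ∑ x : Pair A,
    (stateLaw M s₀ t h x.1 * Λ.act t h x.1 x.2) •
      (Measure.dirac x).prod (M.rew x : Measure I)
  measurable' := by
    refine Measure.measurable_of_measurable_coe _ fun B _ => ?_
    simp only [Measure.coe_finsetSum, Finset.sum_apply, Measure.smul_apply, smul_eq_mul]
    refine Finset.measurable_sum _ fun x _ => Measurable.mul_const ?_ _
    exact (measurable_stateLaw M s₀ t x.1).mul (Λ.measurable_act t x.1 x.2)

lemma sum_pair_eq_one (p : PMF S) (q : ∀ s, PMF (A s)) :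
    ∑ x : Pair A, p x.1 * q x.1 x.2 = 1 := by
  classical
  have h1 : ∑ x : Pair A, p x.1 * q x.1 x.2 = ∑ s, ∑ a, p s * q s a :=
    (Fintype.sum_equiv (Equiv.refl _) _ _ fun _ => rfl).trans
      (Fintype.sum_sigma (fun x : Σ s, A s => p x.1 * q x.1 x.2))
  have h2 : ∀ s, ∑ a, q s a = 1 := fun s => by
    rw [← tsum_fintype (L := .unconditional _)]
    exact (q s).tsum_coe
  rw [h1]
  simp only [← Finset.mul_sum, h2, mul_one]
  rw [← tsum_fintype (L := .unconditional _)]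
  exact p.tsum_coe

instance (M : MDP A) (Λ : Learner A) (s₀ : S) (t : ℕ) :
    IsMarkovKernel (stepKernel M Λ s₀ t) where
  isProbabilityMeasure h := ⟨by
    change (∑ x : Pair A, (stateLaw M s₀ t h x.1 * Λ.act t h x.1 x.2) •
      (Measure.dirac x).prod (M.rew x : Measure I)) Set.univ = 1
    simpa only [Measure.coe_finsetSum, Finset.sum_apply, Measure.smul_apply, smul_eq_mul,
      measure_univ, mul_one] using sum_pair_eq_one (stateLaw M s₀ t h) (Λ.act t h)⟩

/-- The law, under `M`, the agent `Λ` and the initial state `s₀`, of the first `T` steps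
`(X_t, R_t)`, `0 ≤ t < T`. -/
def histLaw (M : MDP A) (Λ : Learner A) (s₀ : S) : ∀ T : ℕ, Measure (Fin T → Obs A)
  | 0 => Measure.dirac Fin.elim0
  | T + 1 => ((histLaw M Λ s₀ T) ⊗ₘ (stepKernel M Λ s₀ T)).map
      fun p => (Fin.snoc p.1 p.2 : Fin (T + 1) → Obs A)

lemma measurable_snoc {α : Type*} [MeasurableSpace α] (T : ℕ) :
    Measurable fun p : (Fin T → α) × α => (Fin.snoc p.1 p.2 : Fin (T + 1) → α) := by
  refine measurable_pi_lambda _ fun i => ?_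
  refine Fin.lastCases ?_ (fun j => ?_) i
  · simpa using measurable_snd
  · simp only [Fin.snoc_castSucc]
    exact (measurable_pi_apply j).comp measurable_fst

instance isProbabilityMeasure_histLaw (M : MDP A) (Λ : Learner A) (s₀ : S) (T : ℕ) :
    IsProbabilityMeasure (histLaw M Λ s₀ T) := by
  induction T with
  | zero => exact inferInstanceAs (IsProbabilityMeasure (Measure.dirac _))
  | succ T ih => exact Measure.isProbabilityMeasure_map (measurable_snoc T).aemeasurable

open Classical in
/-- The number of visits `N_T(x)` of the pair `x` during the first `T` steps. -/
def visits {S : Type u} {A : S → Type v} {T : ℕ} (h : Fin T → Obs A) (x : Pair A) : ℕ :=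
  (Finset.univ.filter fun i => (h i).1 = x).card

/-- The expected cumulative reward of the first `T` steps. -/
def expReward (M : MDP A) (Λ : Learner A) (s₀ : S) (T : ℕ) : ℝ :=
  ∫ h, (∑ i, ((h i).2 : ℝ)) ∂(histLaw M Λ s₀ T)

/-! ### Gain, optimal policies, regret and consistency -/

/-- The gain of a stationary policy, i.e. its long-run average reward.  (The limit exists for
stationary policies of a finite Markov decision process, so it is the `liminf`.) -/
def gain (M : MDP A) (π : Policy A) (s : S) : ℝ :=
  liminf (fun T : ℕ => expReward M π.toLearner s T / T) atTop

/-- The optimal gain. -/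
def optGain (M : MDP A) (s : S) : ℝ := ⨆ π : Policy A, gain M π s

/-- The set of gain-optimal policies. -/
def optPolicies (M : MDP A) : Set (Policy A) := {π | ∀ s, gain M π s = optGain M s}

/-- The expected regret after `T` steps. -/
def regret (M : MDP A) (Λ : Learner A) (s₀ : S) (T : ℕ) : ℝ :=
  T * optGain M s₀ - expReward M Λ s₀ T

/-- Consistency of an agent on a set `𝓜` of models: subpolynomial regret on every model
of `𝓜`, from every initial state. -/
def Consistent (𝓜 : Set (MDP A)) (Λ : Learner A) : Prop :=
  ∀ M ∈ 𝓜, ∀ s₀, ∀ η : ℝ, 0 < η →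
    (fun T : ℕ => regret M Λ s₀ T) =o[atTop] fun T : ℕ => (T : ℝ) ^ η

/-! ### Navigation structure, optimal pairs, confusing models -/

/-- `s'` can be reached from `s` by playing pairs of `X₀` only. -/
def Reaches {S : Type u} {A : S → Type v} (M : MDP A) (X₀ : Set (Pair A)) : S → S → Prop :=
  Relation.ReflTransGen fun s s' => ∃ x ∈ X₀, x.1 = s ∧ M.trans x s' ≠ 0

/-- Every state can be reached from every other one. -/
def Communicating {S : Type u} {A : S → Type v} (M : MDP A) : Prop :=
  ∀ s s', Reaches M Set.univ s s'

/-- The pairs that are played with positive probability by a policy. -/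
def Policy.support {S : Type u} {A : S → Type v} (π : Policy A) : Set (Pair A) :=
  {x | π x.1 x.2 ≠ 0}

/-- The recurrent pairs of a policy: the pairs in its support whose state is recurrent for the
(finite) Markov chain induced by the policy, i.e. can be reached again from every state to which
it leads. -/
def recurrentPairs {S : Type u} {A : S → Type v} (M : MDP A) (π : Policy A) : Set (Pair A) :=
  {x | x ∈ π.support ∧ ∀ s', Reaches M π.support x.1 s' → Reaches M π.support s' x.1}

/-- The optimal pairs: the recurrent pairs of the gain-optimal policies. -/
def optPairs (M : MDP A) : Set (Pair A) := ⋃ π ∈ optPolicies M, recurrentPairs M π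

/-- `Dominates M' M` is `M' ≫ M`: transition and reward laws of `M` are absolutely continuous
with respect to those of `M'`. -/
def Dominates {S : Type u} {A : S → Type v} (M' M : MDP A) : Prop :=
  ∀ x, (∀ s, M'.trans x s = 0 → M.trans x s = 0) ∧ (M.rew x : Measure I) ≪ (M'.rew x : Measure I)

/-- The confusing models of `M` in the set `𝓜`: those that dominate `M`, coincide with `M` on the
optimal pairs of `M`, and have no gain-optimal policy in common with `M`. -/
def confusing (𝓜 : Set (MDP A)) (M : MDP A) : Set (MDP A) :=
  {M' | M' ∈ 𝓜 ∧ Dominates M' M ∧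
    (∀ x ∈ optPairs M, M'.trans x = M.trans x ∧ M'.rew x = M.rew x) ∧
    optPolicies M' ∩ optPolicies M = ∅}

/-! ### Contraction and invariant measures -/

/-- Two states are identified when they are equal or lie in the same communicating component of
`X₀`, i.e. when each one can be reached from the other by playing pairs of `X₀`. -/
def contractSetoid {S : Type u} {A : S → Type v} (M : MDP A) (X₀ : Set (Pair A)) : Setoid S where
  r s s' := Reaches M X₀ s s' ∧ Reaches M X₀ s' s
  iseqv :=
    { refl := fun _ => ⟨Relation.ReflTransGen.refl, Relation.ReflTransGen.refl⟩
      symm := fun h => ⟨h.2, h.1⟩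
      trans := fun h h' => ⟨h.1.trans h'.1, h'.2.trans h.2⟩ }

/-- The states of the contraction. -/
def CState {S : Type u} {A : S → Type v} (M : MDP A) (X₀ : Set (Pair A)) : Type u :=
  Quotient (contractSetoid M X₀)

/-- The state `[s]` of the contraction. -/
def cmk {S : Type u} {A : S → Type v} (M : MDP A) (X₀ : Set (Pair A)) (s : S) : CState M X₀ :=
  Quotient.mk (contractSetoid M X₀) s

instance (M : MDP A) (X₀ : Set (Pair A)) : Fintype (CState M X₀) :=
  have : Finite (CState M X₀) := inferInstanceAs (Finite (Quotient (contractSetoid M X₀)))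
  Fintype.ofFinite _

/-- The actions available in `c`: the disjoint union of the actions of the states `s` with
`[s] = c`. -/
def CAct {S : Type u} {A : S → Type v} (M : MDP A) (X₀ : Set (Pair A)) (c : CState M X₀) :
    Type (max u v) :=
  Σ s : {s : S // cmk M X₀ s = c}, A s

instance (M : MDP A) (X₀ : Set (Pair A)) (c : CState M X₀) : Fintype (CAct M X₀ c) := by
  classical exact inferInstanceAs (Fintype (Σ s : {s : S // cmk M X₀ s = c}, A s))

/-- The canonical bijection between the pairs of `M` and those of its contraction. -/
def pairEquiv {S : Type u} {A : S → Type v} (M : MDP A) (X₀ : Set (Pair A)) :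
    Pair A ≃ Pair (CAct M X₀) where
  toFun x := ⟨cmk M X₀ x.1, ⟨⟨x.1, rfl⟩, x.2⟩⟩
  invFun y := ⟨y.2.1.1, y.2.2⟩
  left_inv _ := rfl
  right_inv := by
    rintro ⟨c, ⟨⟨s, rfl⟩, a⟩⟩
    rfl

/-- The contraction `M / X₀`, where every communicating component of `X₀` becomes a single
state. -/
def contraction {S : Type u} {A : S → Type v} (M : MDP A) (X₀ : Set (Pair A)) :
    MDP (CAct M X₀) where
  trans y := (M.trans ((pairEquiv M X₀).symm y)).map (cmk M X₀)
  rew y := M.rew ((pairEquiv M X₀).symm y)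

open Classical in
/-- The invariant measures of a model: the nonnegative vectors on pairs for which the mass leaving
each state is the mass entering it. -/
def invariantMeasures (M : MDP A) : Set (Pair A → ℝ) :=
  {μ | (∀ x, 0 ≤ μ x) ∧
    ∀ s, ∑ x : Pair A with x.1 = s, μ x = ∑ x : Pair A, μ x * (M.trans x s).toReal}

/-- The invariant measures of `M / X₀` that are probability vectors, as vectors on the pairs
of `M` through the canonical bijection. -/
def contractedInvariantProbs (M : MDP A) (X₀ : Set (Pair A)) : Set (Pair A → ℝ) :=
  {μ | (fun y => μ ((pairEquiv M X₀).symm y)) ∈ invariantMeasures (contraction M X₀) ∧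
    μ ∈ stdSimplex ℝ (Pair A)}

/-! ### The normalized visit vector -/

open Classical in
/-- The expected number of visits of non-optimal pairs during the first `T` steps. -/
def expNonOptVisits (M : MDP A) (Λ : Learner A) (s₀ : S) (T : ℕ) : ℝ :=
  ∫ h, (∑ x : Pair A with x ∉ optPairs M, (visits h x : ℝ)) ∂(histLaw M Λ s₀ T)

/-- The normalized expected visit vector on non-optimal pairs. -/
def navVector (M : MDP A) (Λ : Learner A) (s₀ : S) (T : ℕ) (x : Pair A) : ℝ :=
  ((∫ h, (visits h x : ℝ) ∂(histLaw M Λ s₀ T)) * (optPairs M)ᶜ.indicator 1 x) /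
    expNonOptVisits M Λ s₀ T

end NavMDP

end

/-!
The visits of any agent conserve flow: up to a boundary term in `[-1, 1]`, a set of states is left
as often as it is entered, in expectation (`abs_sum_visits_sub_le`). An optimal pair never leaves
its communicating component of optimal pairs (`cmk_eq_of_mem_optPairs`), so it does not contribute
to the flow between merged states, and the visits of the non-optimal pairs alone are balanced in the
contraction up to a bounded error. After normalization the error is at most the inverse of the
expected number of non-optimal visits. If this number tends to infinity, every limit point of the
normalized vectors is invariant, and compactness of the simplex gives the rest.

The expected number of non-optimal visits is monotone in the horizon; suppose that it is bounded,
and let `M'` be a confusing model. Only the steps at non-optimal pairs contribute to the likelihood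
ratio of `M'` to `M`. With the reward densities truncated at a large constant
(`exists_truncation`, `LikelihoodBound.lintegral_le`), a change of measure shows that under `M'` the
agent plays at most `K` non-optimal pairs of `M`, at every horizon, with a probability at least
`δ > 0` (`exists_prob_countOff_le`). No finiteness of relative entropies is needed.

This is costly in `M'`. Communicating models satisfy the average-reward optimality equation
(`exists_bellman`, by vanishing discount; the span of the discounted values is controlled by a
Lyapunov function), and so does `M'`, which dominates `M`. The gain `g'` of `M'` exceeds the gain
`g` of `M` (`gain_lt_of_confusing`). On optimal pairs of `M` the two models agree, so the potential
of `M` shows that at most `g` per step is earned there, up to a constant. A potential that switches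
from the one of `M` to the one of `M'` at the `(K + 1)`-st step at a non-optimal pair
(`condStep_switchPot_le`) turns this into a regret in `M'` of at least `(g' - g) * δ * T` up to a
constant, which contradicts consistency.
-/

set_option linter.unusedSectionVars false

namespace NavMDP

universe u v

variable {S : Type u} [Fintype S] {A : S → Type v} [∀ s, Fintype (A s)]

/-! ### Averages over transitions and over one step of interaction -/

/-- The mean of a function under a distribution on a finite type. -/
noncomputable def avg {ι : Type*} [Fintype ι] (p : PMF ι) (u : ι → ℝ) : ℝ :=
  ∑ s, (p s).toReal * u s

lemma sum_toReal_eq_one {ι : Type*} [Fintype ι] (p : PMF ι) : ∑ s, (p s).toReal = 1 := by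
  rw [← ENNReal.toReal_sum fun s _ => p.apply_ne_top s,
    ← tsum_fintype (L := .unconditional _), p.tsum_coe, ENNReal.toReal_one]

section avg
variable {ι : Type*} [Fintype ι] (p : PMF ι)

@[simp] lemma avg_const (c : ℝ) : avg p (fun _ => c) = c := by
  rw [avg, ← Finset.sum_mul, sum_toReal_eq_one, one_mul]

lemma avg_add (u w : ι → ℝ) : avg p (fun s => u s + w s) = avg p u + avg p w := by
  simp only [avg, mul_add, Finset.sum_add_distrib]

lemma avg_sub (u w : ι → ℝ) : avg p (fun s => u s - w s) = avg p u - avg p w := by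
  simp only [avg, mul_sub, Finset.sum_sub_distrib]

lemma avg_const_mul (c : ℝ) (u : ι → ℝ) : avg p (fun s => c * u s) = c * avg p u := by
  simp only [avg, Finset.mul_sum]
  exact Finset.sum_congr rfl fun s _ => by ring

lemma avg_mono_of_support {u w : ι → ℝ} (h : ∀ s, p s ≠ 0 → u s ≤ w s) : avg p u ≤ avg p w := by
  refine Finset.sum_le_sum fun s _ => ?_
  by_cases hs : p s = 0
  · simp [hs]
  · exact mul_le_mul_of_nonneg_left (h s hs) ENNReal.toReal_nonneg

lemma avg_mono {u w : ι → ℝ} (h : ∀ s, u s ≤ w s) : avg p u ≤ avg p w :=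
  avg_mono_of_support p fun s _ => h s

lemma abs_avg_le {u : ι → ℝ} {C : ℝ} (h : ∀ s, |u s| ≤ C) : |avg p u| ≤ C := by
  rw [abs_le]
  constructor
  · simpa using avg_mono p (u := fun _ => -C) fun s => (abs_le.1 (h s)).1
  · simpa using avg_mono p (w := fun _ => C) fun s => (abs_le.1 (h s)).2

end avg

lemma sum_pair {β : Type*} [AddCommMonoid β] (f : Pair A → β) :
    ∑ x : Pair A, f x = ∑ s, ∑ a, f ⟨s, a⟩ :=
  (Fintype.sum_equiv (Equiv.refl _) _ _ fun _ => rfl).trans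
    (Fintype.sum_sigma (fun x : Σ s, A s => f x))

/-- The mean reward of a pair. -/
noncomputable def meanRew (M : MDP A) (x : Pair A) : ℝ := ∫ r, (r : ℝ) ∂(M.rew x : Measure I)

lemma integrable_coe_rew (M : MDP A) (x : Pair A) :
    Integrable (fun r : I => (r : ℝ)) (M.rew x : Measure I) :=
  Integrable.of_bound measurable_subtype_coe.aestronglyMeasurable 1
    (ae_of_all _ fun r => by rw [Real.norm_eq_abs, abs_of_nonneg r.2.1]; exact r.2.2)

lemma meanRew_nonneg (M : MDP A) (x : Pair A) : 0 ≤ meanRew M x :=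
  integral_nonneg fun r => r.2.1

lemma meanRew_le_one (M : MDP A) (x : Pair A) : meanRew M x ≤ 1 := by
  have h := integral_mono (integrable_coe_rew M x) (integrable_const (1 : ℝ)) fun r => r.2.2
  simpa [meanRew] using h

/-- The probability that the next pair is `x`, given the history `h`. -/
noncomputable def stepWeight (M : MDP A) (Λ : Learner A) (s₀ : S) {T : ℕ} (h : Fin T → Obs A)
    (x : Pair A) : ℝ≥0∞ :=
  stateLaw M s₀ T h x.1 * Λ.act T h x.1 x.2

/-- The mean of a function of the next pair, given the history `h`. -/
noncomputable def stepAvg (M : MDP A) (Λ : Learner A) (s₀ : S) {T : ℕ} (h : Fin T → Obs A)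
    (G : Pair A → ℝ) : ℝ :=
  ∑ x, (stepWeight M Λ s₀ h x).toReal * G x

section stepAvg
variable (M : MDP A) (Λ : Learner A) (s₀ : S) {T : ℕ} (h : Fin T → Obs A)

lemma stepWeight_ne_top (x : Pair A) : stepWeight M Λ s₀ h x ≠ ∞ :=
  ENNReal.mul_ne_top (PMF.apply_ne_top _ _) (PMF.apply_ne_top _ _)

lemma stepAvg_state (u : S → ℝ) :
    stepAvg M Λ s₀ h (fun x => u x.1) = avg (stateLaw M s₀ T h) u := by
  rw [stepAvg, sum_pair]
  refine Finset.sum_congr rfl fun s _ => ?_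
  simp only [stepWeight, ENNReal.toReal_mul]
  rw [← Finset.sum_mul, ← Finset.mul_sum, sum_toReal_eq_one, mul_one]

@[simp] lemma stepAvg_const (c : ℝ) : stepAvg M Λ s₀ h (fun _ => c) = c := by
  simpa using stepAvg_state M Λ s₀ h fun _ => c

lemma stepAvg_add (G H : Pair A → ℝ) :
    stepAvg M Λ s₀ h (fun x => G x + H x) = stepAvg M Λ s₀ h G + stepAvg M Λ s₀ h H := by
  simp only [stepAvg, mul_add, Finset.sum_add_distrib]

lemma stepAvg_mono_of_weight {G H : Pair A → ℝ}
    (hGH : ∀ x, stepWeight M Λ s₀ h x ≠ 0 → G x ≤ H x) :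
    stepAvg M Λ s₀ h G ≤ stepAvg M Λ s₀ h H := by
  refine Finset.sum_le_sum fun x _ => ?_
  by_cases hx : stepWeight M Λ s₀ h x = 0
  · simp [hx]
  · exact mul_le_mul_of_nonneg_left (hGH x hx) ENNReal.toReal_nonneg

end stepAvg

/-- Bounded measurable functions, the class of functions of the history that are integrated. -/
def BddMeas {α : Type*} [MeasurableSpace α] (F : α → ℝ) : Prop :=
  Measurable F ∧ ∃ C, ∀ a, |F a| ≤ C

namespace BddMeas
variable {α : Type*} [MeasurableSpace α] {F G : α → ℝ}

lemma const (c : ℝ) : BddMeas fun _ : α => c := ⟨measurable_const, |c|, fun _ => le_rfl⟩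

lemma add (hF : BddMeas F) (hG : BddMeas G) : BddMeas fun a => F a + G a := by
  obtain ⟨hF, C, hC⟩ := hF
  obtain ⟨hG, D, hD⟩ := hG
  exact ⟨hF.add hG, C + D, fun a => (abs_add_le _ _).trans (add_le_add (hC a) (hD a))⟩

lemma const_mul (c : ℝ) (hF : BddMeas F) : BddMeas fun a => c * F a := by
  obtain ⟨hF, C, hC⟩ := hF
  refine ⟨hF.const_mul c, |c| * C, fun a => ?_⟩
  rw [abs_mul]
  exact mul_le_mul_of_nonneg_left (hC a) (abs_nonneg c)

lemma sub (hF : BddMeas F) (hG : BddMeas G) : BddMeas fun a => F a - G a := by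
  simpa [sub_eq_add_neg] using hF.add (hG.const_mul (-1))

lemma sum {ι : Type*} (s : Finset ι) {F : ι → α → ℝ} (hF : ∀ i ∈ s, BddMeas (F i)) :
    BddMeas fun a => ∑ i ∈ s, F i a := by
  classical
  induction s using Finset.induction_on with
  | empty => simpa using const (α := α) 0
  | insert i s hi ih =>
    simp only [Finset.sum_insert hi]
    exact (hF i (Finset.mem_insert_self i s)).add
      (ih fun j hj => hF j (Finset.mem_insert_of_mem hj))

lemma ite {p : α → Prop} [DecidablePred p] (hp : MeasurableSet {a | p a}) (hF : BddMeas F)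
    (hG : BddMeas G) : BddMeas fun a => if p a then F a else G a := by
  obtain ⟨hF, C, hC⟩ := hF
  obtain ⟨hG, D, hD⟩ := hG
  refine ⟨Measurable.ite hp hF hG, max C D, fun a => ?_⟩
  change |if p a then F a else G a| ≤ max C D
  split_ifs
  · exact (hC a).trans (le_max_left _ _)
  · exact (hD a).trans (le_max_right _ _)

lemma comp {β : Type*} [MeasurableSpace β] (hF : BddMeas F) {g : β → α} (hg : Measurable g) :
    BddMeas fun b => F (g b) :=
  ⟨hF.1.comp hg, hF.2.imp fun _ hC _ => hC _⟩

lemma integrable (hF : BddMeas F) (μ : Measure α) [IsFiniteMeasure μ] : Integrable F μ := by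
  obtain ⟨hF, C, hC⟩ := hF
  exact Integrable.of_bound hF.aestronglyMeasurable C (ae_of_all _ hC)

end BddMeas

/-! ### The law of the history, one step at a time -/

lemma measurable_snoc_right {α : Type*} [MeasurableSpace α] {T : ℕ} (h : Fin T → α) :
    Measurable fun o : α => (Fin.snoc h o : Fin (T + 1) → α) :=
  (measurable_snoc T).comp measurable_prodMk_left

lemma measurable_snoc_rew {T : ℕ} (h : Fin T → Obs A) (x : Pair A) :
    Measurable fun r : I => (Fin.snoc h (x, r) : Fin (T + 1) → Obs A) :=
  (measurable_snoc_right h).comp measurable_prodMk_left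

lemma lintegral_stepKernel (M : MDP A) (Λ : Learner A) (s₀ : S) {T : ℕ} (h : Fin T → Obs A)
    {F : Obs A → ℝ≥0∞} (hF : Measurable F) :
    ∫⁻ o, F o ∂(stepKernel M Λ s₀ T h) =
      ∑ x, stepWeight M Λ s₀ h x * ∫⁻ r, F (x, r) ∂(M.rew x : Measure I) := by
  change ∫⁻ o, F o ∂(∑ x : Pair A, (stateLaw M s₀ T h x.1 * Λ.act T h x.1 x.2) •
      (Measure.dirac x).prod (M.rew x : Measure I)) = _
  rw [lintegral_finsetSum_measure]
  refine Finset.sum_congr rfl fun x _ => ?_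
  rw [lintegral_smul_measure, Measure.dirac_prod, lintegral_map hF measurable_prodMk_left]
  rfl

lemma integral_stepKernel (M : MDP A) (Λ : Learner A) (s₀ : S) {T : ℕ} (h : Fin T → Obs A)
    {F : Obs A → ℝ} (hF : BddMeas F) :
    ∫ o, F o ∂(stepKernel M Λ s₀ T h) =
      stepAvg M Λ s₀ h fun x => ∫ r, F (x, r) ∂(M.rew x : Measure I) := by
  change ∫ o, F o ∂(∑ x : Pair A, (stateLaw M s₀ T h x.1 * Λ.act T h x.1 x.2) •
      (Measure.dirac x).prod (M.rew x : Measure I)) = _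
  rw [integral_finsetSum_measure]
  · refine Finset.sum_congr rfl fun x _ => ?_
    rw [integral_smul_measure, Measure.dirac_prod,
      integral_map measurable_prodMk_left.aemeasurable hF.1.aestronglyMeasurable]
    rfl
  · intro x _
    exact (hF.integrable _).smul_measure (stepWeight_ne_top M Λ s₀ h x)

lemma lintegral_histLaw_succ (M : MDP A) (Λ : Learner A) (s₀ : S) (T : ℕ)
    {F : (Fin (T + 1) → Obs A) → ℝ≥0∞} (hF : Measurable F) :
    ∫⁻ h, F h ∂(histLaw M Λ s₀ (T + 1)) =
      ∫⁻ h, ∑ x, stepWeight M Λ s₀ h x *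
        ∫⁻ r, F (Fin.snoc h (x, r)) ∂(M.rew x : Measure I) ∂(histLaw M Λ s₀ T) := by
  rw [histLaw, lintegral_map hF (measurable_snoc T),
    Measure.lintegral_compProd (f := fun p => F (Fin.snoc p.1 p.2)) (hF.comp (measurable_snoc T))]
  exact lintegral_congr fun h =>
    lintegral_stepKernel M Λ s₀ h (hF.comp (measurable_snoc_right h))

/-- The mean, given a history of `T` steps, of a function of the history of `T + 1` steps. -/
noncomputable def condStep (M : MDP A) (Λ : Learner A) (s₀ : S) {T : ℕ}
    (F : (Fin (T + 1) → Obs A) → ℝ) (h : Fin T → Obs A) : ℝ :=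
  stepAvg M Λ s₀ h fun x => ∫ r, F (Fin.snoc h (x, r)) ∂(M.rew x : Measure I)

lemma integral_histLaw_succ (M : MDP A) (Λ : Learner A) (s₀ : S) (T : ℕ)
    {F : (Fin (T + 1) → Obs A) → ℝ} (hF : BddMeas F) :
    Integrable (condStep M Λ s₀ F) (histLaw M Λ s₀ T) ∧
    ∫ h, F h ∂(histLaw M Λ s₀ (T + 1)) =
      ∫ h, condStep M Λ s₀ F h ∂(histLaw M Λ s₀ T) := by
  have hk : ∀ h : Fin T → Obs A, ∫ o, F (Fin.snoc h o) ∂(stepKernel M Λ s₀ T h) =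
      condStep M Λ s₀ F h := fun h =>
    integral_stepKernel M Λ s₀ h (hF.comp (measurable_snoc_right h))
  have hi : Integrable (fun p : (Fin T → Obs A) × Obs A => F (Fin.snoc p.1 p.2))
      (histLaw M Λ s₀ T ⊗ₘ stepKernel M Λ s₀ T) := (hF.comp (measurable_snoc T)).integrable _
  constructor
  · simpa [hk] using MeasureTheory.Integrable.integral_compProd (a := ()) hi
  · rw [histLaw, integral_map (measurable_snoc T).aemeasurable hF.1.aestronglyMeasurable,
      Measure.integral_compProd hi]
    exact integral_congr_ae (ae_of_all _ hk)

lemma integral_histLaw_succ_le (M : MDP A) (Λ : Learner A) (s₀ : S) (T : ℕ)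
    {F : (Fin (T + 1) → Obs A) → ℝ} {G : (Fin T → Obs A) → ℝ} (hF : BddMeas F) (hG : BddMeas G)
    (hFG : ∀ h, condStep M Λ s₀ F h ≤ G h) :
    ∫ h, F h ∂(histLaw M Λ s₀ (T + 1)) ≤ ∫ h, G h ∂(histLaw M Λ s₀ T) := by
  obtain ⟨hi, he⟩ := integral_histLaw_succ M Λ s₀ T hF
  rw [he]
  exact integral_mono hi (hG.integrable _) hFG

lemma integral_histLaw_zero (M : MDP A) (Λ : Learner A) (s₀ : S)
    (F : (Fin 0 → Obs A) → ℝ) : ∫ h, F h ∂(histLaw M Λ s₀ 0) = F Fin.elim0 := by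
  rw [histLaw, integral_dirac]

/-! ### Additive functions of the history -/

/-- The sum of a function of the steps along the history. -/
def cum {β : Type*} [AddCommMonoid β] (f : Obs A → β) {T : ℕ} (h : Fin T → Obs A) : β :=
  ∑ i, f (h i)

@[simp] lemma cum_snoc {β : Type*} [AddCommMonoid β] (f : Obs A → β) {T : ℕ} (h : Fin T → Obs A)
    (o : Obs A) : cum f (Fin.snoc h o : Fin (T + 1) → Obs A) = cum f h + f o := by
  simp [cum, Fin.sum_univ_castSucc]

@[simp] lemma cum_zero {β : Type*} [AddCommMonoid β] (f : Obs A → β) (h : Fin 0 → Obs A) :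
    cum f h = 0 := by
  simp [cum]

lemma BddMeas.cum {f : Obs A → ℝ} (hf : BddMeas f) (T : ℕ) :
    BddMeas fun h : Fin T → Obs A => NavMDP.cum f h :=
  BddMeas.sum _ fun i _ => hf.comp (measurable_pi_apply i)

lemma bddMeas_avg_stateLaw (M : MDP A) (s₀ : S) (T : ℕ) (u : S → ℝ) :
    BddMeas fun h : Fin T → Obs A => avg (stateLaw M s₀ T h) u := by
  refine ⟨Finset.measurable_sum _ fun s _ =>
    (measurable_stateLaw M s₀ T s).ennreal_toReal.mul_const _, ∑ s, |u s|, fun h => ?_⟩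
  exact abs_avg_le _ fun s => Finset.single_le_sum (f := fun s => |u s|)
    (fun _ _ => abs_nonneg _) (Finset.mem_univ s)

@[simp] lemma stateLaw_snoc (M : MDP A) (s₀ : S) {T : ℕ} (h : Fin T → Obs A) (o : Obs A) :
    stateLaw M s₀ (T + 1) (Fin.snoc h o) = M.trans o.1 := by
  simp [stateLaw]

lemma bddMeas_rew : BddMeas fun o : Obs A => (o.2 : ℝ) :=
  ⟨measurable_subtype_coe.comp measurable_snd, 1, fun o => by
    rw [abs_of_nonneg o.2.2.1]; exact o.2.2.2⟩

lemma bddMeas_pair (G : Pair A → ℝ) : BddMeas fun o : Obs A => G o.1 := by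
  refine ⟨measurable_from_top.comp measurable_fst, ∑ x, |G x|, fun o => ?_⟩
  exact Finset.single_le_sum (f := fun x => |G x|) (fun _ _ => abs_nonneg _) (Finset.mem_univ o.1)

lemma integral_rew_add (M : MDP A) (x : Pair A) (c : ℝ) :
    ∫ r, (c + (r : ℝ)) ∂(M.rew x : Measure I) = c + meanRew M x := by
  rw [integral_add (integrable_const _) (integrable_coe_rew M x)]
  simp [meanRew]

/-! ### A Lyapunov function for reaching a set of states -/

lemma exists_pos_le_of_pos {ι : Type*} [Finite ι] (f : ι → ℝ) :
    ∃ ρ, 0 < ρ ∧ ρ ≤ 1 ∧ ∀ i, 0 < f i → ρ ≤ f i := by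
  classical
  have := Fintype.ofFinite ι
  suffices H : ∀ s : Finset ι, ∃ ρ, 0 < ρ ∧ ρ ≤ 1 ∧ ∀ i ∈ s, 0 < f i → ρ ≤ f i by
    simpa using H Finset.univ
  intro s
  induction s using Finset.induction_on with
  | empty => exact ⟨1, one_pos, le_rfl, by simp⟩
  | insert i s _ ih =>
    obtain ⟨ρ, h0, h1, hρ⟩ := ih
    by_cases hi : 0 < f i
    · refine ⟨min ρ (f i), lt_min h0 hi, (min_le_left _ _).trans h1, fun j hj hfj => ?_⟩
      rcases Finset.mem_insert.1 hj with rfl | hj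
      · exact min_le_right _ _
      · exact (min_le_left _ _).trans (hρ j hj hfj)
    · refine ⟨ρ, h0, h1, fun j hj hfj => ?_⟩
      rcases Finset.mem_insert.1 hj with rfl | hj
      · exact absurd hfj hi
      · exact hρ j hj hfj

lemma toReal_pos_of_ne_zero {ι : Type*} (p : PMF ι) {s : ι} (hs : p s ≠ 0) :
    0 < (p s).toReal :=
  ENNReal.toReal_pos hs (p.apply_ne_top s)

/-- The states from which `C` can be reached in at most `n` steps with pairs of `X₀`. -/
def reachSet (M : MDP A) (X₀ : Set (Pair A)) (C : Set S) : ℕ → Set S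
  | 0 => C
  | n + 1 => {s | ∃ x ∈ X₀, x.1 = s ∧ ∃ s' ∈ reachSet M X₀ C n, M.trans x s' ≠ 0} ∪
      reachSet M X₀ C n

lemma exists_mem_reachSet (M : MDP A) (X₀ : Set (Pair A)) (C : Set S) {s c : S} (hc : c ∈ C)
    (h : Reaches M X₀ s c) : ∃ n, s ∈ reachSet M X₀ C n := by
  induction h using Relation.ReflTransGen.head_induction_on with
  | refl => exact ⟨0, hc⟩
  | head h _ ih =>
    obtain ⟨n, hn⟩ := ih
    obtain ⟨x, hx, rfl, hp⟩ := h
    exact ⟨n + 1, Or.inl ⟨x, hx, rfl, _, hn, hp⟩⟩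

/-- If `C` can be reached from everywhere with pairs of `X₀`, there is a bounded function that is
maximal on `C` and that some pair of `X₀` increases by at least `1` on average in every state
outside of `C`. The function is `Q ^ (n - d s)`, with `d s` the distance from `s` to `C` and `Q`
large compared with the inverse of the least transition probability. -/
lemma exists_lyapunov (M : MDP A) (X₀ : Set (Pair A)) (C : Set S)
    (hC : ∀ s, ∃ c ∈ C, Reaches M X₀ s c) :
    ∃ (e : S → ℝ) (B : ℝ), (∀ s, 0 ≤ e s ∧ e s ≤ B) ∧ (∀ s ∈ C, e s = B) ∧
      ∀ s ∉ C, ∃ x ∈ X₀, x.1 = s ∧ e s + 1 ≤ avg (M.trans x) e := by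
  classical
  have hex : ∀ s, ∃ n, s ∈ reachSet M X₀ C n := fun s => by
    obtain ⟨c, hc, h⟩ := hC s
    exact exists_mem_reachSet M X₀ C hc h
  let d : S → ℕ := fun s => Nat.find (hex s)
  obtain ⟨ρ, hρ0, hρ1, hρ⟩ := exists_pos_le_of_pos fun y : Pair A × S => (M.trans y.1 y.2).toReal
  let n : ℕ := Finset.univ.sup d
  have hdn : ∀ s, d s ≤ n := fun s => Finset.le_sup (f := d) (Finset.mem_univ s)
  have hQ : 1 ≤ 2 / ρ := by rw [le_div_iff₀ hρ0]; linarith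
  have hQ0 : 0 ≤ 2 / ρ := by linarith
  refine ⟨fun s => (2 / ρ) ^ (n - d s), (2 / ρ) ^ n, fun s => ⟨pow_nonneg hQ0 _,
    pow_le_pow_right₀ hQ (Nat.sub_le _ _)⟩, fun s hs => ?_, fun s hs => ?_⟩
  · have : d s = 0 := (Nat.find_eq_zero _).2 hs
    simp [this]
  · obtain ⟨m, hm⟩ : ∃ m, d s = m + 1 :=
      Nat.exists_eq_succ_of_ne_zero fun h0 => hs ((Nat.find_eq_zero (hex s)).1 h0)
    have hmem : s ∈ reachSet M X₀ C (m + 1) := hm ▸ Nat.find_spec (hex s)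
    have hnot : s ∉ reachSet M X₀ C m := Nat.find_min (hex s) (by change m < d s; omega)
    obtain ⟨x, hx, hxs, s', hs', hp⟩ := hmem.resolve_right hnot
    refine ⟨x, hx, hxs, ?_⟩
    have hd : d s' ≤ m := Nat.find_min' (hex s') hs'
    have hle : n - d s + 1 ≤ n - d s' := by have := hdn s; omega
    calc (2 / ρ) ^ (n - d s) + 1 ≤ (2 / ρ) ^ (n - d s) + (2 / ρ) ^ (n - d s) := by
          gcongr; exact one_le_pow₀ hQ
      _ = ρ * (2 / ρ) ^ (n - d s + 1) := by rw [pow_succ]; field_simp; ring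
      _ ≤ ρ * (2 / ρ) ^ (n - d s') := by gcongr
      _ ≤ (M.trans x s').toReal * (2 / ρ) ^ (n - d s') := by
          gcongr; exact hρ (x, s') (toReal_pos_of_ne_zero _ hp)
      _ ≤ avg (M.trans x) fun s => (2 / ρ) ^ (n - d s) :=
          Finset.single_le_sum (f := fun s => (M.trans x s).toReal * (2 / ρ) ^ (n - d s))
            (fun _ _ => mul_nonneg ENNReal.toReal_nonneg (pow_nonneg hQ0 _)) (Finset.mem_univ s')

/-! ### The average-reward optimality equation of a communicating model -/

section bellman
variable [∀ s, Nonempty (A s)]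

/-- The optimality operator of `M` with discount factor `γ`. -/
noncomputable def bellmanOp (M : MDP A) (γ : ℝ) (V : S → ℝ) (s : S) : ℝ :=
  Finset.univ.sup' Finset.univ_nonempty fun a : A s =>
    meanRew M ⟨s, a⟩ + γ * avg (M.trans ⟨s, a⟩) V

lemma le_bellmanOp (M : MDP A) (γ : ℝ) (V : S → ℝ) (x : Pair A) :
    meanRew M x + γ * avg (M.trans x) V ≤ bellmanOp M γ V x.1 :=
  Finset.le_sup' (fun a : A x.1 => meanRew M ⟨x.1, a⟩ + γ * avg (M.trans ⟨x.1, a⟩) V)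
    (Finset.mem_univ x.2)

lemma exists_bellmanOp_eq (M : MDP A) (γ : ℝ) (V : S → ℝ) (s : S) :
    ∃ a, bellmanOp M γ V s = meanRew M ⟨s, a⟩ + γ * avg (M.trans ⟨s, a⟩) V := by
  obtain ⟨a, -, ha⟩ := Finset.exists_mem_eq_sup' (Finset.univ_nonempty (α := A s))
    fun a : A s => meanRew M ⟨s, a⟩ + γ * avg (M.trans ⟨s, a⟩) V
  exact ⟨a, ha⟩

lemma bellmanOp_le_add (M : MDP A) {γ : ℝ} (hγ : 0 ≤ γ) (V W : S → ℝ) (s : S) :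
    bellmanOp M γ V s ≤ bellmanOp M γ W s + γ * dist V W := by
  obtain ⟨a, ha⟩ := exists_bellmanOp_eq M γ V s
  have h1 := le_bellmanOp M γ W ⟨s, a⟩
  have h2 : avg (M.trans ⟨s, a⟩) V - avg (M.trans ⟨s, a⟩) W ≤ dist V W := by
    rw [← avg_sub]
    refine (le_abs_self _).trans (abs_avg_le _ fun s' => ?_)
    exact dist_le_pi_dist V W s'
  have h3 := mul_le_mul_of_nonneg_left h2 hγ
  rw [ha]
  simp only at h1
  linarith

lemma exists_discounted_value (M : MDP A) {γ : ℝ} (hγ : 0 ≤ γ) (hγ1 : γ < 1) :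
    ∃ V : S → ℝ, bellmanOp M γ V = V := by
  have hc : ContractingWith ⟨γ, hγ⟩ (bellmanOp M γ : (S → ℝ) → S → ℝ) := by
    refine ⟨by exact_mod_cast hγ1, LipschitzWith.of_dist_le_mul fun V W => ?_⟩
    refine (dist_pi_le_iff (mul_nonneg hγ dist_nonneg)).2 fun s => ?_
    rw [Real.dist_eq, abs_sub_le_iff]
    have h1 := bellmanOp_le_add M hγ V W s
    have h2 := bellmanOp_le_add M hγ W V s
    rw [dist_comm] at h2
    change _ ≤ γ * dist V W ∧ _ ≤ γ * dist V W
    constructor <;> linarith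
  exact ⟨_, hc.fixedPoint_isFixedPt⟩

lemma discounted_value_mem_Icc (M : MDP A) {γ : ℝ} (hγ : 0 ≤ γ) (hγ1 : γ < 1) {V : S → ℝ}
    (hV : bellmanOp M γ V = V) (s : S) : (1 - γ) * V s ∈ Set.Icc (0 : ℝ) 1 := by
  have : Nonempty S := ⟨s⟩
  obtain ⟨b, hb⟩ := Finite.exists_max V
  obtain ⟨c, hc⟩ := Finite.exists_min V
  constructor
  · have a := (inferInstance : Nonempty (A c)).some
    have h1 := le_bellmanOp M γ V ⟨c, a⟩
    have h2 := meanRew_nonneg M ⟨c, a⟩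
    have h3 : V c ≤ avg (M.trans ⟨c, a⟩) V := by
      simpa using avg_mono (M.trans ⟨c, a⟩) hc
    rw [hV] at h1
    have h4 := mul_le_mul_of_nonneg_left h3 hγ
    have h5 : 0 ≤ (1 - γ) * V c := by simp only at h1; linarith
    exact h5.trans (mul_le_mul_of_nonneg_left (hc s) (by linarith))
  · obtain ⟨a, ha⟩ := exists_bellmanOp_eq M γ V b
    have h2 := meanRew_le_one M ⟨b, a⟩
    have h3 : avg (M.trans ⟨b, a⟩) V ≤ V b := by
      simpa using avg_mono (M.trans ⟨b, a⟩) hb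
    rw [hV] at ha
    have h4 := mul_le_mul_of_nonneg_left h3 hγ
    have h5 : (1 - γ) * V b ≤ 1 := by linarith
    exact (mul_le_mul_of_nonneg_left (hb s) (by linarith)).trans h5

/-- The span of the discounted value is bounded uniformly in the discount factor. With `s'` a
state of largest value and `e` a Lyapunov function for reaching `s'`, the function
`V s' - V s + 2 * e s` is maximal at `s'`, since elsewhere some pair increases it on average. -/
lemma exists_span_bound (M : MDP A) (hM : Communicating M) :
    ∃ B : ℝ, ∀ γ : ℝ, 0 ≤ γ → γ < 1 → ∀ V : S → ℝ, bellmanOp M γ V = V →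
      ∀ s s', |V s - V s'| ≤ B := by
  have hL := fun c : S => exists_lyapunov M Set.univ {c} fun s => ⟨c, rfl, hM s c⟩
  choose e B heB heC he using hL
  refine ⟨∑ c, 2 * B c, fun γ hγ hγ1 V hV s s' => ?_⟩
  have : Nonempty S := ⟨s⟩
  obtain ⟨b, hb⟩ := Finite.exists_max V
  have hD : ∀ s, V b - V s ≤ 2 * B b := by
    obtain ⟨t, ht⟩ := Finite.exists_max fun s => (V b - V s) + 2 * e b s
    have htb : t = b := by
      by_contra hne
      obtain ⟨x, -, rfl, hx⟩ := he b t hne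
      have h1 := le_bellmanOp M γ V x
      rw [hV] at h1
      have h2 := meanRew_nonneg M x
      have h3 := avg_mono (M.trans x) ht
      rw [avg_add, avg_const_mul, avg_const, avg_sub, avg_const] at h3
      have h4 := (discounted_value_mem_Icc M hγ hγ1 hV b).2
      have h5 : avg (M.trans x) V ≤ V b := by
        simpa using avg_mono (M.trans x) hb
      nlinarith
    intro s
    have h1 := ht s
    subst htb
    have h2 := (heB t s).1
    have h3 := (heB t t).2
    simp only [sub_self] at h1
    linarith
  have hB : 2 * B b ≤ ∑ c, 2 * B c :=
    Finset.single_le_sum (f := fun c => 2 * B c)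
      (fun c _ => by have := heB c c; linarith) (Finset.mem_univ b)
  rw [abs_sub_le_iff]
  have h1 := hD s
  have h2 := hD s'
  have h3 := hb s
  have h4 := hb s'
  constructor <;> linarith

/-- The optimality equation `g + h s = max_a (r (s, a) + ∑ s', p (s' | s, a) h s')` of a
communicating model, obtained by letting the discount factor tend to `1`. -/
lemma exists_bellman (M : MDP A) (hM : Communicating M) (s₀ : S) :
    ∃ (g : ℝ) (h : S → ℝ) (f : ∀ s, A s),
      (∀ x, meanRew M x + avg (M.trans x) h ≤ g + h x.1) ∧
      ∀ s, meanRew M ⟨s, f s⟩ + avg (M.trans ⟨s, f s⟩) h = g + h s := by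
  obtain ⟨B, hB⟩ := exists_span_bound M hM
  let γ : ℕ → ℝ := fun n => 1 - 1 / ((n : ℝ) + 1)
  have hγ0 : ∀ n, 0 ≤ γ n := fun n => by
    have : 1 / ((n : ℝ) + 1) ≤ 1 := by
      rw [div_le_one (by positivity)]; linarith [n.cast_nonneg (α := ℝ)]
    simp only [γ]; linarith
  have hγ1 : ∀ n, γ n < 1 := fun n => by
    have : 0 < 1 / ((n : ℝ) + 1) := by positivity
    simp only [γ]; linarith
  have hγt : Tendsto γ atTop (𝓝 1) := by
    simpa [γ] using tendsto_const_nhds.sub (tendsto_one_div_add_atTop_nhds_zero_nat (𝕜 := ℝ))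
  choose V hV using fun n => exists_discounted_value M (hγ0 n) (hγ1 n)
  let w : ℕ → (S → ℝ) × ℝ := fun n => (fun s => V n s - V n s₀, (1 - γ n) * V n s₀)
  have hw : ∀ n, w n ∈ Set.Icc ((fun _ => -B, 0) : (S → ℝ) × ℝ) (fun _ => B, 1) := fun n => by
    have h1 := fun s => abs_le.1 (hB (γ n) (hγ0 n) (hγ1 n) (V n) (hV n) s s₀)
    have h2 := discounted_value_mem_Icc M (hγ0 n) (hγ1 n) (hV n) s₀
    exact ⟨⟨fun s => (h1 s).1, h2.1⟩, fun s => (h1 s).2, h2.2⟩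
  obtain ⟨⟨h, g⟩, -, φ, hφ, hlim⟩ := isCompact_Icc.tendsto_subseq hw
  have hh : ∀ s, Tendsto (fun n => (w (φ n)).1 s) atTop (𝓝 (h s)) := fun s =>
    ((continuous_apply s).comp continuous_fst).continuousAt.tendsto.comp hlim
  have hg : Tendsto (fun n => (w (φ n)).2) atTop (𝓝 g) :=
    continuous_snd.continuousAt.tendsto.comp hlim
  have hγφ := hγt.comp hφ.tendsto_atTop
  have havg : ∀ x, Tendsto (fun n => avg (M.trans x) (w (φ n)).1) atTop
      (𝓝 (avg (M.trans x) h)) := fun x =>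
    tendsto_finsetSum _ fun s _ => (hh s).const_mul _
  have heq : ∀ n s, (w n).2 + (w n).1 s = bellmanOp M (γ n) (w n).1 s := fun n s => by
    have key : ∀ x : Pair A, meanRew M x + γ n * avg (M.trans x) (V n) =
        meanRew M x + γ n * avg (M.trans x) (w n).1 + γ n * V n s₀ := fun x => by
      simp only [w]
      rw [avg_sub, avg_const]; ring
    have hVs : (w n).2 + (w n).1 s = V n s - γ n * V n s₀ := by simp only [w]; ring
    rw [hVs]
    apply le_antisymm
    · obtain ⟨a, ha⟩ := exists_bellmanOp_eq M (γ n) (V n) s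
      rw [hV n] at ha
      have h1 := le_bellmanOp M (γ n) (w n).1 ⟨s, a⟩
      have h2 := key ⟨s, a⟩
      simp only at h1
      linarith
    · obtain ⟨a, ha⟩ := exists_bellmanOp_eq M (γ n) (w n).1 s
      have h1 := le_bellmanOp M (γ n) (V n) ⟨s, a⟩
      have h2 := key ⟨s, a⟩
      rw [hV n] at h1
      simp only at h1
      linarith
  have hlimeq : ∀ s, g + h s = bellmanOp M 1 h s := fun s => by
    have h1 : Tendsto (fun n => bellmanOp M (γ (φ n)) (w (φ n)).1 s) atTop
        (𝓝 (bellmanOp M 1 h s)) :=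
      Tendsto.finset_sup'_nhds_apply Finset.univ_nonempty fun a _ =>
        tendsto_const_nhds.add (hγφ.mul (havg ⟨s, a⟩))
    refine tendsto_nhds_unique ((hg.add (hh s)).congr fun n => ?_) h1
    exact heq (φ n) s
  choose f hf using exists_bellmanOp_eq M 1 h
  refine ⟨g, h, f, fun x => ?_, fun s => ?_⟩
  · rw [hlimeq]
    simpa using le_bellmanOp M 1 h x
  · rw [hlimeq, hf, one_mul]

end bellman

/-! ### Rewards and gains -/

lemma exists_abs_le {ι : Type*} [Fintype ι] (u : ι → ℝ) : ∃ B, 0 ≤ B ∧ ∀ i, |u i| ≤ B :=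
  ⟨∑ i, |u i|, Finset.sum_nonneg fun _ _ => abs_nonneg _, fun i =>
    Finset.single_le_sum (f := fun i => |u i|) (fun _ _ => abs_nonneg _) (Finset.mem_univ i)⟩

/-- The sum of the rewards of a history. -/
def rewSum {T : ℕ} (h : Fin T → Obs A) : ℝ := cum (fun o => (o.2 : ℝ)) h

lemma bddMeas_rewSum (T : ℕ) : BddMeas fun h : Fin T → Obs A => rewSum h := bddMeas_rew.cum T

@[simp] lemma rewSum_snoc {T : ℕ} (h : Fin T → Obs A) (o : Obs A) :
    rewSum (Fin.snoc h o : Fin (T + 1) → Obs A) = rewSum h + o.2 := by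
  simp [rewSum]

lemma expReward_eq (M : MDP A) (Λ : Learner A) (s₀ : S) (T : ℕ) :
    expReward M Λ s₀ T = ∫ h, rewSum h ∂(histLaw M Λ s₀ T) := rfl

lemma condStep_rewSum_add (M : MDP A) (Λ : Learner A) (s₀ : S) {T : ℕ} (h : Fin T → Obs A)
    {ψ : (Fin (T + 1) → Obs A) → ℝ} {k : Pair A → ℝ}
    (hk : ∀ x r, ψ (Fin.snoc h (x, r)) = k x) :
    condStep M Λ s₀ (fun h' => rewSum h' + ψ h') h =
      rewSum h + stepAvg M Λ s₀ h fun x => meanRew M x + k x := by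
  have h1 : ∀ x, ∫ r, (rewSum (Fin.snoc h (x, r) : Fin (T + 1) → Obs A) +
      ψ (Fin.snoc h (x, r))) ∂(M.rew x : Measure I) = rewSum h + (meanRew M x + k x) := by
    intro x
    rw [← add_assoc, add_right_comm, ← integral_rew_add]
    exact integral_congr_ae (ae_of_all _ fun r => by simp only [rewSum_snoc, hk]; ring)
  simp only [condStep, h1]
  rw [stepAvg_add, stepAvg_const]

/-- The rewards collected so far plus the mean potential of the next state. -/
noncomputable def rewPot (M : MDP A) (s₀ : S) (u : S → ℝ) {T : ℕ} (h : Fin T → Obs A) : ℝ :=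
  rewSum h + avg (stateLaw M s₀ T h) u

lemma bddMeas_rewPot (M : MDP A) (s₀ : S) (u : S → ℝ) (T : ℕ) :
    BddMeas fun h : Fin T → Obs A => rewPot M s₀ u h :=
  (bddMeas_rewSum T).add (bddMeas_avg_stateLaw M s₀ T u)

lemma condStep_rewPot (M : MDP A) (Λ : Learner A) (s₀ : S) (u : S → ℝ) {T : ℕ}
    (h : Fin T → Obs A) :
    condStep M Λ s₀ (fun h' => rewPot M s₀ u h') h =
      rewSum h + stepAvg M Λ s₀ h fun x => meanRew M x + avg (M.trans x) u :=
  condStep_rewSum_add M Λ s₀ h fun x r => by rw [stateLaw_snoc]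

lemma avg_pure (s₀ : S) (u : S → ℝ) : avg (PMF.pure s₀) u = u s₀ := by
  classical
  rw [avg, Finset.sum_eq_single s₀]
  · simp
  · intro b _ hb
    simp [PMF.pure_apply, hb]
  · simp

lemma rewPot_zero (M : MDP A) (s₀ : S) (u : S → ℝ) (h : Fin 0 → Obs A) :
    rewPot M s₀ u h = u s₀ := by
  simp [rewPot, rewSum, stateLaw, avg_pure]

lemma abs_expReward_sub_le (M : MDP A) (Λ : Learner A) (s₀ : S) {u : S → ℝ} {B : ℝ}
    (hB : ∀ s, |u s| ≤ B) (T : ℕ) :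
    |expReward M Λ s₀ T - ∫ h, rewPot M s₀ u h ∂(histLaw M Λ s₀ T)| ≤ B := by
  have h1 : ∫ h, rewPot M s₀ u h ∂(histLaw M Λ s₀ T) = expReward M Λ s₀ T +
      ∫ h, avg (stateLaw M s₀ T h) u ∂(histLaw M Λ s₀ T) :=
    integral_add ((bddMeas_rewSum T).integrable _) ((bddMeas_avg_stateLaw M s₀ T u).integrable _)
  rw [h1, sub_add_cancel_left, abs_neg]
  have h2 := norm_integral_le_of_norm_le_const (μ := histLaw M Λ s₀ T)
    (f := fun h => avg (stateLaw M s₀ T h) u) (C := B)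
    (ae_of_all _ fun h => abs_avg_le (stateLaw M s₀ T h) hB)
  simpa using h2

/-- A solution of the optimality inequality bounds the rewards of every agent. -/
lemma exists_expReward_le (M : MDP A) (Λ : Learner A) (s₀ : S) {g : ℝ} {u : S → ℝ}
    (hu : ∀ x, meanRew M x + avg (M.trans x) u ≤ g + u x.1) :
    ∃ C, ∀ T : ℕ, expReward M Λ s₀ T ≤ g * T + C := by
  obtain ⟨B, -, hB⟩ := exists_abs_le u
  have key : ∀ T : ℕ, ∫ h, rewPot M s₀ u h ∂(histLaw M Λ s₀ T) ≤ g * T + u s₀ := by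
    intro T
    induction T with
    | zero => rw [integral_histLaw_zero, rewPot_zero]; simp
    | succ T ih =>
      have hstep := integral_histLaw_succ_le M Λ s₀ T (bddMeas_rewPot M s₀ u (T + 1))
        ((BddMeas.const g).add (bddMeas_rewPot M s₀ u T)) fun h => by
          rw [condStep_rewPot]
          have h1 := stepAvg_mono_of_weight M Λ s₀ h (fun x _ => hu x)
          rw [stepAvg_add _ _ _ _ (fun _ => g), stepAvg_const, stepAvg_state] at h1
          simp only [rewPot]
          linarith
      rw [integral_add (integrable_const _) ((bddMeas_rewPot M s₀ u T).integrable _)] at hstep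
      simp only [integral_const, probReal_univ, one_smul] at hstep
      push_cast
      linarith
  refine ⟨u s₀ + B, fun T => ?_⟩
  have h1 := (abs_le.1 (abs_expReward_sub_le M Λ s₀ hB T)).2
  have h2 := key T
  linarith

/-- The reverse optimality inequality on the support of a policy bounds the rewards of the policy
from below. -/
lemma exists_le_expReward_policy (M : MDP A) (π : Policy A) (s₀ : S) {g : ℝ} {u : S → ℝ}
    (hu : ∀ x ∈ π.support, g + u x.1 ≤ meanRew M x + avg (M.trans x) u) :
    ∃ C, ∀ T : ℕ, g * T - C ≤ expReward M π.toLearner s₀ T := by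
  obtain ⟨B, -, hB⟩ := exists_abs_le u
  have key : ∀ T : ℕ, g * T + u s₀ ≤ ∫ h, rewPot M s₀ u h ∂(histLaw M π.toLearner s₀ T) := by
    intro T
    induction T with
    | zero => rw [integral_histLaw_zero, rewPot_zero]; simp
    | succ T ih =>
      obtain ⟨hi, he⟩ := integral_histLaw_succ M π.toLearner s₀ T (bddMeas_rewPot M s₀ u (T + 1))
      have hstep : ∫ h, (g + rewPot M s₀ u h) ∂(histLaw M π.toLearner s₀ T) ≤
          ∫ h, rewPot M s₀ u h ∂(histLaw M π.toLearner s₀ (T + 1)) := by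
        rw [he]
        refine integral_mono (((BddMeas.const g).add (bddMeas_rewPot M s₀ u T)).integrable _) hi
          fun h => ?_
        simp only
        rw [condStep_rewPot]
        have h1 := stepAvg_mono_of_weight M π.toLearner s₀ h
          (G := fun x => g + u x.1) fun x hx => hu x fun h0 => hx (by
            simp only [stepWeight, Policy.toLearner, h0, mul_zero])
        rw [stepAvg_add _ _ _ _ (fun _ => g), stepAvg_const, stepAvg_state] at h1
        simp only [rewPot]
        linarith
      rw [integral_add (integrable_const _) ((bddMeas_rewPot M s₀ u T).integrable _)] at hstep
      simp only [integral_const, probReal_univ, one_smul] at hstep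
      push_cast
      linarith
  refine ⟨B - u s₀, fun T => ?_⟩
  have h1 := (abs_le.1 (abs_expReward_sub_le M π.toLearner s₀ hB T)).1
  have h2 := key T
  linarith

lemma expReward_div_mem_Icc (M : MDP A) (Λ : Learner A) (s₀ : S) (T : ℕ) :
    expReward M Λ s₀ T / T ∈ Set.Icc (0 : ℝ) 1 := by
  have h0 : 0 ≤ expReward M Λ s₀ T :=
    integral_nonneg fun h => Finset.sum_nonneg fun i _ => (h i).2.2.1
  refine ⟨div_nonneg h0 T.cast_nonneg, div_le_one_of_le₀ ?_ T.cast_nonneg⟩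
  have h1 := integral_mono ((bddMeas_rewSum T).integrable (histLaw M Λ s₀ T))
    (integrable_const (T : ℝ)) fun h => by
      have := Finset.sum_le_sum fun i (_ : i ∈ Finset.univ) => (h i).2.2.2
      simpa [rewSum, cum] using this
  simpa [expReward_eq] using h1

lemma tendsto_const_add_div (g C : ℝ) : Tendsto (fun T : ℕ => g + C / T) atTop (𝓝 g) := by
  simpa using tendsto_const_nhds.add (tendsto_const_div_atTop_nhds_zero_nat C)

lemma gain_le (M : MDP A) (π : Policy A) (s : S) {g : ℝ} {u : S → ℝ}
    (hu : ∀ x, meanRew M x + avg (M.trans x) u ≤ g + u x.1) : gain M π s ≤ g := by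
  obtain ⟨C, hC⟩ := exists_expReward_le M π.toLearner s hu
  have ht := tendsto_const_add_div g C
  rw [← ht.liminf_eq]
  refine liminf_le_liminf ?_ (isBoundedUnder_of ⟨0, fun T =>
    (expReward_div_mem_Icc M π.toLearner s T).1⟩) ht.isBoundedUnder_le.isCoboundedUnder_ge
  filter_upwards [eventually_gt_atTop 0] with T hT
  have hT' : (0 : ℝ) < T := by exact_mod_cast hT
  rw [div_le_iff₀ hT', add_mul, div_mul_cancel₀ _ hT'.ne']
  exact hC T

lemma le_gain (M : MDP A) (π : Policy A) (s : S) {g : ℝ} {u : S → ℝ}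
    (hu : ∀ x ∈ π.support, g + u x.1 ≤ meanRew M x + avg (M.trans x) u) : g ≤ gain M π s := by
  obtain ⟨C, hC⟩ := exists_le_expReward_policy M π s hu
  have ht := tendsto_const_add_div g (-C)
  rw [← ht.liminf_eq]
  have hb : IsBoundedUnder (· ≤ ·) atTop fun T : ℕ => expReward M π.toLearner s T / T :=
    isBoundedUnder_of ⟨1, fun T => (expReward_div_mem_Icc M π.toLearner s T).2⟩
  refine liminf_le_liminf ?_ ht.isBoundedUnder_ge hb.isCoboundedUnder_ge
  filter_upwards [eventually_gt_atTop 0] with T hT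
  have hT' : (0 : ℝ) < T := by exact_mod_cast hT
  rw [le_div_iff₀ hT', add_mul, div_mul_cancel₀ _ hT'.ne', ← sub_eq_add_neg]
  exact hC T

/-- The deterministic policy that plays `f s` in the state `s`. -/
noncomputable def detPolicy (f : ∀ s, A s) : Policy A := fun s => PMF.pure (f s)

lemma mem_support_detPolicy {f : ∀ s, A s} {x : Pair A} :
    x ∈ (detPolicy f).support ↔ x = ⟨x.1, f x.1⟩ := by
  classical
  obtain ⟨s, a⟩ := x
  have h1 : (⟨s, a⟩ : Pair A) ∈ (detPolicy f).support ↔ a = f s := by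
    change PMF.pure (f s) a ≠ 0 ↔ _
    simp
  exact h1.trans ⟨fun h => by rw [h], fun h => eq_of_heq (Sigma.mk.inj h).2⟩

/-- The gain of a policy is at most the constant `g` of an optimality inequality; if a policy has
the gain `g` everywhere, it is optimal and `g` is the optimal gain. -/
lemma optGain_eq_of_le_gain (M : MDP A) {g : ℝ} {u : S → ℝ}
    (hu : ∀ x, meanRew M x + avg (M.trans x) u ≤ g + u x.1) (π : Policy A)
    (hπ : ∀ s, g ≤ gain M π s) : (∀ s, optGain M s = g) ∧ π ∈ optPolicies M := by
  have h1 : ∀ s, optGain M s = g := fun s => by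
    have : Nonempty (Policy A) := ⟨π⟩
    have hb : BddAbove (Set.range fun π : Policy A => gain M π s) :=
      ⟨g, by rintro _ ⟨π, rfl⟩; exact gain_le M π s hu⟩
    exact le_antisymm (ciSup_le fun π => gain_le M π s hu) ((hπ s).trans (le_ciSup hb π))
  exact ⟨h1, fun s => by rw [h1]; exact le_antisymm (gain_le M π s hu) (hπ s)⟩

lemma optGain_eq_of_bellman (M : MDP A) {g : ℝ} {u : S → ℝ} {f : ∀ s, A s}
    (hu : ∀ x, meanRew M x + avg (M.trans x) u ≤ g + u x.1)
    (hf : ∀ s, meanRew M ⟨s, f s⟩ + avg (M.trans ⟨s, f s⟩) u = g + u s) :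
    (∀ s, optGain M s = g) ∧ detPolicy f ∈ optPolicies M := by
  refine optGain_eq_of_le_gain M hu _ fun s => le_gain M _ s (u := u) fun x hx => ?_
  rw [mem_support_detPolicy] at hx
  rw [hx]
  exact (hf x.1).ge

/-! ### Confusing models have a larger gain -/

lemma Reaches.of_dominates {M M' : MDP A} (hd : Dominates M' M) {X₀ : Set (Pair A)} {s s' : S}
    (h : Reaches M X₀ s s') : Reaches M' X₀ s s' := by
  refine Relation.ReflTransGen.mono ?_ _ _ h
  rintro a b ⟨x, hx, hxa, hp⟩
  exact ⟨x, hx, hxa, fun h0 => hp ((hd x).1 b h0)⟩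

/-- In a finite graph every vertex leads to a recurrent one: one that leads to as few vertices as
possible. -/
lemma exists_reaches_recurrent (M : MDP A) (X₀ : Set (Pair A)) (s : S) :
    ∃ c ∈ {c | ∀ s', Reaches M X₀ c s' → Reaches M X₀ s' c}, Reaches M X₀ s c := by
  obtain ⟨c, hc, hmin⟩ := Set.exists_min_image {c | Reaches M X₀ s c}
    (fun c => {s' | Reaches M X₀ c s'}.ncard) (Set.toFinite _) ⟨s, Relation.ReflTransGen.refl⟩
  refine ⟨c, fun s' hs' => ?_, hc⟩
  have hsub : {t | Reaches M X₀ s' t} ⊆ {t | Reaches M X₀ c t} := fun t ht => hs'.trans ht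
  have heq := Set.eq_of_subset_of_ncard_le hsub (hmin s' (hc.trans hs')) (Set.toFinite _)
  have : c ∈ {t | Reaches M X₀ c t} := Relation.ReflTransGen.refl
  rw [← heq] at this
  exact this

/-- A confusing model has a larger gain. Its optimal gain is at least that of `M`, because the
recurrent classes in `M` of an optimal policy are recurrent classes with the same rewards in the
confusing model and are still reached from everywhere; and if the gains were equal, this policy
would be optimal in both models. -/
lemma gain_lt_of_confusing {𝓜 : Set (MDP A)} {M M' : MDP A} (hM' : M' ∈ confusing 𝓜 M)
    {g g' : ℝ} {u u' : S → ℝ} {f : ∀ s, A s}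
    (hu : ∀ x, meanRew M x + avg (M.trans x) u ≤ g + u x.1)
    (hf : ∀ s, meanRew M ⟨s, f s⟩ + avg (M.trans ⟨s, f s⟩) u = g + u s)
    (hu' : ∀ x, meanRew M' x + avg (M'.trans x) u' ≤ g' + u' x.1) : g < g' := by
  obtain ⟨-, hd, hag, hdisj⟩ := hM'
  by_contra! hle
  have hopt := (optGain_eq_of_bellman M hu hf).2
  let X₀ := (detPolicy f).support
  let C : Set S := {c | ∀ s', Reaches M X₀ c s' → Reaches M X₀ s' c}
  obtain ⟨e, B, heB, heC, he⟩ := exists_lyapunov M' X₀ C fun s => by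
    obtain ⟨c, hc, h⟩ := exists_reaches_recurrent M X₀ s
    exact ⟨c, hc, h.of_dominates hd⟩
  obtain ⟨H, hH0, hH⟩ := exists_abs_le u
  have hgain : ∀ s, g ≤ gain M' (detPolicy f) s := fun s =>
    le_gain M' _ s (u := fun s => u s + (|g| + 2 * H) * e s) fun x hx => by
      have hxf := mem_support_detPolicy.1 hx
      rw [avg_add, avg_const_mul]
      have hK : 0 ≤ |g| + 2 * H := by positivity
      by_cases hxC : x.1 ∈ C
      · have hxo : x ∈ optPairs M := Set.mem_biUnion hopt ⟨hx, hxC⟩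
        obtain ⟨ht, hr⟩ := hag x hxo
        have h1 : B ≤ avg (M'.trans x) e := by
          have h2 := avg_mono_of_support (M'.trans x) (u := fun _ => B) (w := e) fun s' hs' => by
            rw [ht] at hs'
            have hstep : Reaches M X₀ x.1 s' := .single ⟨x, hx, rfl, hs'⟩
            exact (heC s' fun t hst => (hxC t (hstep.trans hst)).trans hstep).ge
          simpa using h2
        have h2 := heC _ hxC
        have h3 : meanRew M' x + avg (M'.trans x) u = g + u x.1 := by
          rw [ht, meanRew, hr, hxf]
          exact hf x.1
        have h4 := mul_le_mul_of_nonneg_left h1 hK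
        rw [h2]
        linarith
      · obtain ⟨y, hy, hyx, h1⟩ := he _ hxC
        have hyx' : y = x := by
          rw [hxf, mem_support_detPolicy.1 hy, hyx]
        rw [hyx'] at h1
        have h2 := meanRew_nonneg M' x
        have h3 := (abs_le.1 (abs_avg_le (M'.trans x) hH)).1
        have h4 := mul_le_mul_of_nonneg_left h1 hK
        have h5 := (abs_le.1 (hH x.1)).2
        have h6 := le_abs_self g
        linarith
  have := (optGain_eq_of_le_gain M' hu' (detPolicy f) fun s => hle.trans (hgain s)).2
  exact (Set.eq_empty_iff_forall_notMem.1 hdisj) _ ⟨this, hopt⟩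

/-! ### Counting the steps outside of a set of pairs -/

open Classical in
/-- The number of steps at which a pair outside of `X₀` is played. -/
noncomputable def countOff (X₀ : Set (Pair A)) {T : ℕ} (h : Fin T → Obs A) : ℕ :=
  cum (fun o => if o.1 ∈ X₀ then 0 else 1) h

open Classical in
@[simp] lemma countOff_snoc (X₀ : Set (Pair A)) {T : ℕ} (h : Fin T → Obs A) (o : Obs A) :
    countOff X₀ (Fin.snoc h o : Fin (T + 1) → Obs A) =
      countOff X₀ h + if o.1 ∈ X₀ then 0 else 1 := by
  simp [countOff]

open Classical in
lemma cast_countOff (X₀ : Set (Pair A)) {T : ℕ} (h : Fin T → Obs A) :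
    (countOff X₀ h : ℝ) = cum (fun o => if o.1 ∈ X₀ then 0 else 1) h := by
  simp [countOff, cum]

lemma bddMeas_countOff (X₀ : Set (Pair A)) (T : ℕ) :
    BddMeas fun h : Fin T → Obs A => (countOff X₀ h : ℝ) := by
  classical
  simp only [cast_countOff]
  exact BddMeas.cum (bddMeas_pair fun x => if x ∈ X₀ then 0 else 1) T

lemma measurableSet_countOff_le (X₀ : Set (Pair A)) (T K : ℕ) :
    MeasurableSet {h : Fin T → Obs A | countOff X₀ h ≤ K} := by
  have := measurableSet_le (bddMeas_countOff X₀ T).1 (measurable_const (a := (K : ℝ)))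
  simpa using this

lemma visits_eq_cum {T : ℕ} (h : Fin T → Obs A) (x : Pair A) [DecidableEq (Pair A)] :
    (visits h x : ℝ) = cum (fun o => if o.1 = x then 1 else 0) h := by
  rw [visits, cum, Finset.sum_boole]
  congr!

lemma bddMeas_visits (T : ℕ) (x : Pair A) :
    BddMeas fun h : Fin T → Obs A => (visits h x : ℝ) := by
  classical
  simp only [visits_eq_cum]
  exact BddMeas.cum (bddMeas_pair fun y => if y = x then 1 else 0) T

lemma sum_mul_visits {T : ℕ} (h : Fin T → Obs A) (c : Pair A → ℝ) :
    ∑ x, c x * (visits h x : ℝ) = cum (fun o => c o.1) h := by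
  classical
  simp only [visits_eq_cum, cum, Finset.mul_sum]
  rw [Finset.sum_comm]
  simp

lemma expNonOptVisits_eq (M : MDP A) (Λ : Learner A) (s₀ : S) (T : ℕ) :
    expNonOptVisits M Λ s₀ T = ∫ h, (countOff (optPairs M) h : ℝ) ∂(histLaw M Λ s₀ T) := by
  classical
  refine integral_congr_ae (ae_of_all _ fun h => ?_)
  simp only
  rw [cast_countOff]
  refine Eq.trans ?_ (sum_mul_visits h fun x => if x ∈ optPairs M then 0 else 1)
  rw [Finset.sum_filter]
  refine Finset.sum_congr rfl fun x _ => ?_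
  by_cases hx : x ∈ optPairs M <;> simp [hx]

lemma condStep_cum_add (M : MDP A) (Λ : Learner A) (s₀ : S) {T : ℕ} (h : Fin T → Obs A)
    {f : Obs A → ℝ} (hf : BddMeas f) {ψ : (Fin (T + 1) → Obs A) → ℝ} {k : Pair A → ℝ}
    (hk : ∀ x r, ψ (Fin.snoc h (x, r)) = k x) :
    condStep M Λ s₀ (fun h' => cum f h' + ψ h') h =
      cum f h + stepAvg M Λ s₀ h fun x => ∫ r, f (x, r) ∂(M.rew x : Measure I) + k x := by
  have h1 : ∀ x, ∫ r, (cum f (Fin.snoc h (x, r) : Fin (T + 1) → Obs A) +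
      ψ (Fin.snoc h (x, r))) ∂(M.rew x : Measure I) =
      cum f h + (∫ r, f (x, r) ∂(M.rew x : Measure I) + k x) := by
    intro x
    have hi : Integrable (fun r => f (x, r)) (M.rew x : Measure I) :=
      (hf.comp measurable_prodMk_left).integrable _
    simp only [cum_snoc, hk]
    have hi' : Integrable (fun r => cum f h + f (x, r)) (M.rew x : Measure I) :=
      (integrable_const _).add hi
    rw [integral_add hi' (integrable_const _), integral_add (integrable_const _) hi]
    simp [add_assoc]
  simp only [condStep, h1]
  rw [stepAvg_add, stepAvg_const]

lemma integral_cum_nonpos (M : MDP A) (Λ : Learner A) (s₀ : S) {f : Obs A → ℝ} (hf : BddMeas f)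
    (hf0 : ∀ x, ∫ r, f (x, r) ∂(M.rew x : Measure I) ≤ 0) (T : ℕ) :
    ∫ h, cum f h ∂(histLaw M Λ s₀ T) ≤ 0 := by
  induction T with
  | zero => simp
  | succ T ih =>
    refine (integral_histLaw_succ_le M Λ s₀ T (hf.cum _) (hf.cum _) fun h => ?_).trans ih
    have h1 := condStep_cum_add M Λ s₀ h hf (ψ := fun _ => 0) (k := fun _ => 0) fun _ _ => rfl
    simp only [add_zero] at h1
    rw [h1]
    have h2 := stepAvg_mono_of_weight M Λ s₀ h (fun x _ => hf0 x)
    rw [stepAvg_const] at h2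
    linarith

/-! ### Change of measure -/

/-- Outside of a set of small measure, an absolutely continuous measure is bounded by a multiple
of the dominating one. -/
lemma exists_truncation {α : Type*} [MeasurableSpace α] (μ ν : Measure α) [IsFiniteMeasure μ]
    [IsFiniteMeasure ν] (hμν : μ ≪ ν) {ε : ℝ} (hε : 0 < ε) :
    ∃ (B : Set α) (L : ℝ≥0∞), MeasurableSet B ∧ L ≠ ∞ ∧ μ.real Bᶜ ≤ ε ∧
      ∀ F : α → ℝ≥0∞, Measurable F → ∫⁻ a in B, F a ∂μ ≤ L * ∫⁻ a, F a ∂ν := by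
  let f := μ.rnDeriv ν
  have hf : Measurable f := Measure.measurable_rnDeriv μ ν
  have hlim : Tendsto (fun n : ℕ => μ {a | (n : ℝ≥0∞) < f a}) atTop
      (𝓝 (μ (⋂ n : ℕ, {a | (n : ℝ≥0∞) < f a}))) := by
    refine tendsto_measure_iInter_atTop
      (fun n => (measurableSet_lt measurable_const hf).nullMeasurableSet) ?_
      ⟨0, measure_ne_top _ _⟩
    intro m n hmn a ha
    exact lt_of_le_of_lt (by exact_mod_cast hmn) (show (n : ℝ≥0∞) < f a from ha)
  have hzero : μ (⋂ n : ℕ, {a | (n : ℝ≥0∞) < f a}) = 0 := by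
    have h1 : ∀ᵐ a ∂μ, f a < ∞ := hμν.ae_le (Measure.rnDeriv_lt_top μ ν)
    refine measure_mono_null ?_ h1
    intro a ha hlt
    obtain ⟨n, hn⟩ := ENNReal.exists_nat_gt hlt.ne
    exact (lt_asymm hn) (Set.mem_iInter.1 ha n)
  rw [hzero] at hlim
  obtain ⟨n, hn⟩ := (hlim.eventually_lt_const (ENNReal.ofReal_pos.2 hε)).exists
  refine ⟨{a | f a ≤ n}, n, measurableSet_le hf measurable_const, ENNReal.natCast_ne_top n, ?_,
    fun F hF => ?_⟩
  · have : {a | f a ≤ n}ᶜ = {a | (n : ℝ≥0∞) < f a} := by ext a; simp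
    rw [this]
    exact ENNReal.toReal_le_of_le_ofReal hε.le hn.le
  · have hB : MeasurableSet {a | f a ≤ n} := measurableSet_le hf measurable_const
    calc ∫⁻ a in {a | f a ≤ n}, F a ∂μ
        = ∫⁻ a in {a | f a ≤ n}, F a ∂(ν.withDensity f) := by
          rw [Measure.withDensity_rnDeriv_eq μ ν hμν]
      _ = ∫⁻ a in {a | f a ≤ n}, f a * F a ∂ν := by
          rw [restrict_withDensity hB, lintegral_withDensity_eq_lintegral_mul _ hf hF]
          rfl
      _ ≤ ∫⁻ a in {a | f a ≤ n}, n * F a ∂ν :=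
          setLIntegral_mono (hF.const_mul _) fun a ha => mul_le_mul_left ha _
      _ = n * ∫⁻ a in {a | f a ≤ n}, F a ∂ν := lintegral_const_mul _ hF
      _ ≤ n * ∫⁻ a, F a ∂ν := by gcongr; exact Measure.restrict_le_self

/-- A function `d` of the steps is a likelihood bound of `M` with respect to `M'` if, pair by pair,
the reward law of `M` weighted by `d`, together with the transition law of `M`, is dominated by the
laws of `M'`. -/
def LikelihoodBound (M M' : MDP A) (d : Obs A → ℝ≥0∞) : Prop :=
  Measurable d ∧ ∀ x (F : S → I → ℝ≥0∞), (∀ s, Measurable (F s)) →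
    ∫⁻ r, d (x, r) * ∑ s, M.trans x s * F s r ∂(M.rew x : Measure I) ≤
      ∫⁻ r, ∑ s, M'.trans x s * F s r ∂(M'.rew x : Measure I)

lemma sum_stepWeight_mul (M : MDP A) (Λ : Learner A) (s₀ : S) {T : ℕ} (h : Fin T → Obs A)
    (G : Pair A → ℝ≥0∞) :
    ∑ x, stepWeight M Λ s₀ h x * G x =
      ∑ s, stateLaw M s₀ T h s * ∑ a, Λ.act T h s a * G ⟨s, a⟩ := by
  rw [sum_pair]
  refine Finset.sum_congr rfl fun s _ => ?_
  rw [Finset.mul_sum]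
  exact Finset.sum_congr rfl fun a _ => mul_assoc _ _ _

/-- A likelihood bound of the steps is one for the histories. The statement includes the law of
the state that follows the history, whose transition is charged to the last step. -/
lemma LikelihoodBound.lintegral_le {M M' : MDP A} {d : Obs A → ℝ≥0∞} (hd : LikelihoodBound M M' d)
    (Λ : Learner A) (s₀ : S) (T : ℕ) (F : S → (Fin T → Obs A) → ℝ≥0∞)
    (hF : ∀ s, Measurable (F s)) :
    ∫⁻ h, (∏ i, d (h i)) * ∑ s, stateLaw M s₀ T h s * F s h ∂(histLaw M Λ s₀ T) ≤
      ∫⁻ h, ∑ s, stateLaw M' s₀ T h s * F s h ∂(histLaw M' Λ s₀ T) := by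
  induction T with
  | zero => simp [histLaw, stateLaw]
  | succ T ih =>
    have hsum : ∀ N : MDP A, Measurable fun h : Fin (T + 1) → Obs A =>
        ∑ s, stateLaw N s₀ (T + 1) h s * F s h := fun N =>
      Finset.measurable_sum _ fun s _ => (measurable_stateLaw N s₀ (T + 1) s).mul (hF s)
    have hprod : ∀ n : ℕ, Measurable fun h : Fin n → Obs A => ∏ i, d (h i) := fun n =>
      Finset.measurable_prod _ fun i _ => hd.1.comp (measurable_pi_apply i)
    have hFr : ∀ (h : Fin T → Obs A) x s,
        Measurable fun r : I => F s (Fin.snoc h (x, r) : Fin (T + 1) → Obs A) := fun h x s =>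
      (hF s).comp (measurable_snoc_rew h x)
    let G : (Fin T → Obs A) → Pair A → ℝ≥0∞ := fun h x =>
      ∫⁻ r, ∑ s, M'.trans x s * F s (Fin.snoc h (x, r)) ∂(M'.rew x : Measure I)
    have hG : ∀ x, Measurable fun h => G h x := fun x => by
      refine Measurable.lintegral_prod_right' (f := fun p : (Fin T → Obs A) × I =>
        ∑ s, M'.trans x s * F s (Fin.snoc p.1 (x, p.2))) ?_
      refine Finset.measurable_sum _ fun s _ => Measurable.const_mul ((hF s).comp ?_) _
      exact (measurable_snoc T).comp (measurable_fst.prodMk (measurable_const.prodMk measurable_snd))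
    have hG' : ∀ s, Measurable fun h => ∑ a, Λ.act T h s a * G h ⟨s, a⟩ := fun s =>
      Finset.measurable_sum _ fun a _ => (Λ.measurable_act T s a).mul (hG ⟨s, a⟩)
    have hmul : Measurable fun h : Fin (T + 1) → Obs A =>
        (∏ i, d (h i)) * ∑ s, stateLaw M s₀ (T + 1) h s * F s h := (hprod _).mul (hsum M)
    rw [lintegral_histLaw_succ M Λ s₀ T hmul,
      lintegral_histLaw_succ M' Λ s₀ T (hsum M')]
    simp only [stateLaw_snoc]
    calc _ ≤ ∫⁻ h, (∏ i, d (h i)) * ∑ s, stateLaw M s₀ T h s *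
          ∑ a, Λ.act T h s a * G h ⟨s, a⟩ ∂(histLaw M Λ s₀ T) := by
          refine lintegral_mono fun h => ?_
          simp only
          rw [← sum_stepWeight_mul M Λ s₀ h (G h), Finset.mul_sum]
          refine Finset.sum_le_sum fun x _ => ?_
          rw [mul_left_comm]
          gcongr
          have h1 : ∀ r : I, (∏ i, d ((Fin.snoc h (x, r) : Fin (T + 1) → Obs A) i)) =
              (∏ i, d (h i)) * d (x, r) := fun r => by
            simp [Fin.prod_univ_castSucc]
          simp only [h1, mul_assoc]
          rw [lintegral_const_mul]
          · gcongr
            exact hd.2 x _ (hFr h x)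
          · exact (hd.1.comp measurable_prodMk_left).mul
              (Finset.measurable_sum _ fun s _ => (hFr h x s).const_mul _)
      _ ≤ _ := ih _ hG'
      _ = _ := by
          refine lintegral_congr fun h => ?_
          rw [← sum_stepWeight_mul M' Λ s₀ h (G h)]

/-- The transition laws of `M` are at most a constant times those of a dominating model. -/
lemma exists_trans_le_mul {M M' : MDP A} (hd : Dominates M' M) :
    ∃ L : ℝ≥0∞, L ≠ ∞ ∧ ∀ x s, M.trans x s ≤ L * M'.trans x s := by
  have hfin : ∀ x s, M.trans x s / M'.trans x s ≠ ∞ := fun x s h => by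
    rcases ENNReal.div_eq_top.1 h with ⟨h1, h2⟩ | ⟨h1, -⟩
    · exact h1 ((hd x).1 s h2)
    · exact PMF.apply_ne_top _ _ h1
  refine ⟨∑ x, ∑ s, M.trans x s / M'.trans x s, ?_, fun x s => ?_⟩
  · exact ENNReal.sum_ne_top.2 fun x _ => ENNReal.sum_ne_top.2 fun s _ => hfin x s
  · have h1 : M.trans x s / M'.trans x s ≤ ∑ x, ∑ s, M.trans x s / M'.trans x s :=
      (Finset.single_le_sum (f := fun s => M.trans x s / M'.trans x s)
        (fun _ _ => zero_le) (Finset.mem_univ s)).trans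
      (Finset.single_le_sum (f := fun x => ∑ s, M.trans x s / M'.trans x s)
        (fun _ _ => zero_le) (Finset.mem_univ x))
    refine le_trans ?_ (mul_le_mul_left h1 _)
    by_cases h0 : M'.trans x s = 0
    · simp [(hd x).1 s h0]
    · rw [ENNReal.div_mul_cancel h0 (PMF.apply_ne_top _ _)]

open Classical in
/-- A model that dominates `M` and agrees with `M` on `X₀` admits a likelihood bound that is `1` on
`X₀` and, off `X₀`, a positive constant on a set of rewards of almost full measure and `0`
elsewhere. -/
lemma exists_likelihoodBound {M M' : MDP A} (hd : Dominates M' M) (X₀ : Set (Pair A))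
    (hag : ∀ x ∈ X₀, M'.trans x = M.trans x ∧ M'.rew x = M.rew x) {ε : ℝ} (hε : 0 < ε) :
    ∃ (B : Pair A → Set I) (L : ℝ≥0∞), (∀ x, MeasurableSet (B x)) ∧ L ≠ ∞ ∧ 1 ≤ L ∧
      (∀ x, (M.rew x : Measure I).real (B x)ᶜ ≤ ε) ∧
      LikelihoodBound M M' fun o => if o.1 ∈ X₀ then 1 else if o.2 ∈ B o.1 then L⁻¹ else 0 := by
  choose B Lr hB hLr hBε hBL using fun x => exists_truncation (M.rew x : Measure I)
    (M'.rew x : Measure I) (hd x).2 hε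
  obtain ⟨Lt, hLt, ht⟩ := exists_trans_le_mul hd
  -- Adding `1` makes the constant nonzero, so that it can be inverted.
  let L : ℝ≥0∞ := Lt * ∑ x, Lr x + 1
  have hL : L ≠ ∞ := ENNReal.add_ne_top.2
    ⟨ENNReal.mul_ne_top hLt (ENNReal.sum_ne_top.2 fun x _ => hLr x), ENNReal.one_ne_top⟩
  have hL0 : L ≠ 0 := by simp [L]
  refine ⟨B, L, hB, hL, le_add_self, hBε, ?_, fun x F hF => ?_⟩
  · have h1 : ∀ x, Measurable fun r : I => if x ∈ X₀ then (1 : ℝ≥0∞) else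
        if r ∈ B x then L⁻¹ else 0 := fun x => by
      by_cases hx : x ∈ X₀
      · simp [hx]
      · simp only [hx, if_false]
        exact Measurable.ite (hB x) measurable_const measurable_const
    exact measurable_from_prod_countable_right h1
  · by_cases hx : x ∈ X₀
    · simp [hx, (hag x hx).1, (hag x hx).2]
    · have hm : Measurable fun r => ∑ s, M.trans x s * F s r :=
        Finset.measurable_sum _ fun s _ => (hF s).const_mul _
      have hm' : Measurable fun r => ∑ s, M'.trans x s * F s r :=
        Finset.measurable_sum _ fun s _ => (hF s).const_mul _
      have hind : ∀ r, (if r ∈ B x then L⁻¹ else 0) * ∑ s, M.trans x s * F s r =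
          L⁻¹ * (B x).indicator (fun r => ∑ s, M.trans x s * F s r) r := fun r => by
        by_cases hr : r ∈ B x <;> simp [hr]
      simp only [hx, if_false, hind]
      rw [lintegral_const_mul _ (hm.indicator (hB x)), lintegral_indicator (hB x)]
      calc L⁻¹ * ∫⁻ r in B x, ∑ s, M.trans x s * F s r ∂(M.rew x : Measure I)
          ≤ L⁻¹ * (Lr x * ∫⁻ r, ∑ s, M.trans x s * F s r ∂(M'.rew x : Measure I)) := by
            gcongr; exact hBL x _ hm
        _ ≤ L⁻¹ * (Lr x * ∫⁻ r, Lt * ∑ s, M'.trans x s * F s r ∂(M'.rew x : Measure I)) := by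
            gcongr with r
            rw [Finset.mul_sum]
            refine Finset.sum_le_sum fun s _ => ?_
            rw [← mul_assoc]
            gcongr
            exact ht x s
        _ = L⁻¹ * (Lt * Lr x) * ∫⁻ r, ∑ s, M'.trans x s * F s r ∂(M'.rew x : Measure I) := by
            rw [lintegral_const_mul _ hm']; ring
        _ ≤ L⁻¹ * L * ∫⁻ r, ∑ s, M'.trans x s * F s r ∂(M'.rew x : Measure I) := by
            gcongr
            refine le_trans ?_ le_self_add
            gcongr
            exact Finset.single_le_sum (f := Lr) (fun _ _ => zero_le) (Finset.mem_univ x)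
        _ = _ := by rw [ENNReal.inv_mul_cancel hL0 hL, one_mul]

/-- If the expected number of steps off `X₀` is bounded under `M`, then under a dominating model
that agrees with `M` on `X₀` this number is bounded with a probability bounded below: only boundedly
many steps contribute to the likelihood ratio. -/
lemma exists_prob_countOff_le {M M' : MDP A} (hd : Dominates M' M) (X₀ : Set (Pair A))
    (hag : ∀ x ∈ X₀, M'.trans x = M.trans x ∧ M'.rew x = M.rew x) (Λ : Learner A) (s₀ : S) {C : ℝ}
    (hC : ∀ T, ∫ h, (countOff X₀ h : ℝ) ∂(histLaw M Λ s₀ T) ≤ C) :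
    ∃ K : ℕ, ∃ δ : ℝ, 0 < δ ∧
      ∀ T, δ ≤ (histLaw M' Λ s₀ T).real {h | countOff X₀ h ≤ K} := by
  classical
  have hC0 : 0 ≤ C := (integral_nonneg fun _ => Nat.cast_nonneg _).trans (hC 0)
  -- The constants make the two error terms below at most `1 / 2` and `1 / 4`.
  obtain ⟨K, hK⟩ := exists_nat_ge (2 * C)
  obtain ⟨B, L, hB, hL, hL1, hBε, hLB⟩ := exists_likelihoodBound hd X₀ hag
    (ε := 1 / (4 * (C + 1))) (by positivity)
  have hLi : L⁻¹ ≤ 1 := ENNReal.inv_le_one.2 hL1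
  have hLK : L⁻¹ ^ K ≠ ∞ := ne_top_of_le_ne_top ENNReal.one_ne_top (pow_le_one₀ zero_le hLi)
  refine ⟨K, (L⁻¹ ^ K).toReal * (1 / 4), mul_pos (ENNReal.toReal_pos
    (pow_ne_zero K (ENNReal.inv_ne_zero.2 hL)) hLK) (by norm_num), fun T => ?_⟩
  let bad : Obs A → ℝ := fun o => if o.1 ∈ X₀ then 0 else if o.2 ∈ B o.1 then 0 else 1
  have hbad0 : ∀ o, 0 ≤ bad o := fun o => by simp only [bad]; split_ifs <;> norm_num
  have hbad : BddMeas bad := by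
    refine ⟨measurable_from_prod_countable_right fun x => ?_, 1, fun o => ?_⟩
    · by_cases hx : x ∈ X₀
      · simp [bad, hx]
      · simp only [bad, hx, if_false]
        exact Measurable.ite (hB x) measurable_const measurable_const
    · simp only [bad]; split_ifs <;> norm_num
  let E : Set (Fin T → Obs A) := {h | countOff X₀ h ≤ K} ∩ {h | cum bad h = 0}
  have hE : MeasurableSet E := (measurableSet_countOff_le X₀ T K).inter
    ((hbad.cum T).1 (measurableSet_singleton 0))
  -- On `E` every step off `X₀` has the weight `L⁻¹`, and there are at most `K` of them.
  have hprod : ∀ h ∈ E, L⁻¹ ^ K ≤ ∏ i, if (h i).1 ∈ X₀ then (1 : ℝ≥0∞) else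
      if (h i).2 ∈ B (h i).1 then L⁻¹ else 0 := by
    rintro h ⟨hK, hb⟩
    have hb' := (Finset.sum_eq_zero_iff_of_nonneg fun i _ => hbad0 (h i)).1 hb
    have h1 : ∀ i, (if (h i).1 ∈ X₀ then (1 : ℝ≥0∞) else if (h i).2 ∈ B (h i).1 then L⁻¹ else 0) =
        L⁻¹ ^ (if (h i).1 ∈ X₀ then 0 else 1) := fun i => by
      have h2 := hb' i (Finset.mem_univ i)
      by_cases hx : (h i).1 ∈ X₀
      · simp [hx]
      · by_cases hr : (h i).2 ∈ B (h i).1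
        · simp [hx, hr]
        · simp [bad, hx, hr] at h2
    simp only [h1]
    rw [Finset.prod_pow_eq_pow_sum]
    exact pow_le_pow_of_le_one zero_le hLi hK
  have hchange : L⁻¹ ^ K * histLaw M Λ s₀ T E ≤ histLaw M' Λ s₀ T {h | countOff X₀ h ≤ K} := by
    have hm := measurableSet_countOff_le X₀ T K
    have h1 := hLB.lintegral_le Λ s₀ T (fun _ => {h | countOff X₀ h ≤ K}.indicator 1)
      fun _ => measurable_one.indicator hm
    have h2 : ∀ (N : MDP A) (h : Fin T → Obs A), ∑ s, stateLaw N s₀ T h s = 1 := fun N h => by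
      rw [← tsum_fintype (L := .unconditional _)]
      exact PMF.tsum_coe _
    simp only [← Finset.sum_mul, h2, one_mul] at h1
    rw [lintegral_indicator_one hm] at h1
    refine le_trans ?_ h1
    rw [← lintegral_indicator_const hE]
    refine lintegral_mono fun h => ?_
    by_cases hh : h ∈ E
    · have h3 : h ∈ {h : Fin T → Obs A | countOff X₀ h ≤ K} := hh.1
      simpa [hh, h3] using hprod h hh
    · simp [hh]
  have hbadE : ∫ h, cum bad h ∂(histLaw M Λ s₀ T) ≤ 1 / 4 := by
    let cnt : Obs A → ℝ := fun o => if o.1 ∈ X₀ then 0 else 1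
    have hcnt : BddMeas cnt := bddMeas_pair fun x => if x ∈ X₀ then 0 else 1
    have h1 := integral_cum_nonpos M Λ s₀ (hbad.sub (hcnt.const_mul (1 / (4 * (C + 1)))))
      (fun x => by
        by_cases hx : x ∈ X₀
        · simp [bad, cnt, hx]
        · have h2 : ∀ r, bad (x, r) = (B x)ᶜ.indicator 1 r := fun r => by
            by_cases hr : r ∈ B x <;> simp [bad, hx, hr]
          have h3 : Integrable ((B x)ᶜ.indicator (1 : I → ℝ)) (M.rew x : Measure I) :=
            (integrable_const _).indicator (hB x).compl
          simp only [h2, cnt, hx, if_false]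
          rw [integral_sub h3 (integrable_const _), integral_indicator_one (hB x).compl]
          simpa using hBε x) T
    have h4 : ∀ h : Fin T → Obs A, cum (fun o => bad o - 1 / (4 * (C + 1)) * cnt o) h =
        cum bad h - 1 / (4 * (C + 1)) * countOff X₀ h := fun h => by
      rw [cast_countOff]
      simp only [cum, Finset.sum_sub_distrib, Finset.mul_sum, cnt]
    simp only [h4] at h1
    rw [integral_sub ((hbad.cum T).integrable _)
      (((bddMeas_countOff X₀ T).integrable _).const_mul _), integral_const_mul] at h1
    have h5 : 1 / (4 * (C + 1)) * ∫ h, (countOff X₀ h : ℝ) ∂(histLaw M Λ s₀ T) ≤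
        1 / (4 * (C + 1)) * C := by gcongr; exact hC T
    have h6 : 1 / (4 * (C + 1)) * C ≤ 1 / 4 := by
      rw [one_div_mul_eq_div, div_le_div_iff₀ (by positivity) (by norm_num)]
      linarith
    linarith
  have hPE : 1 / 4 ≤ (histLaw M Λ s₀ T).real E := by
    have hK1 : (0 : ℝ) < K + 1 := by positivity
    have hlow : BddMeas fun h : Fin T → Obs A =>
        1 - 1 / ((K : ℝ) + 1) * (countOff X₀ h : ℝ) - cum bad h :=
      ((BddMeas.const 1).sub ((bddMeas_countOff X₀ T).const_mul _)).sub (hbad.cum T)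
    have h1 := integral_mono (hlow.integrable (histLaw M Λ s₀ T))
      ((integrable_const (1 : ℝ)).indicator hE) fun h => by
        have hb0 : 0 ≤ cum bad h := Finset.sum_nonneg fun i _ => hbad0 (h i)
        have hc0 : 0 ≤ 1 / ((K : ℝ) + 1) * (countOff X₀ h : ℝ) := by positivity
        by_cases hh : h ∈ E
        · simp only [Set.indicator_of_mem hh]; linarith
        · simp only [Set.indicator_of_notMem hh]
          by_cases hcK : countOff X₀ h ≤ K
          · -- The sum of the `0`-`1` valued function `bad` is positive, hence at least `1`.
            have hne : cum bad h ≠ 0 := fun h0 => hh ⟨hcK, h0⟩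
            obtain ⟨i, -, hi⟩ := Finset.exists_ne_zero_of_sum_ne_zero hne
            have hi1 : bad (h i) = 1 := by
              simp only [bad] at hi ⊢
              split_ifs at hi ⊢ <;> simp_all
            have := Finset.single_le_sum (f := fun i => bad (h i)) (fun i _ => hbad0 (h i))
              (Finset.mem_univ i)
            rw [hi1] at this
            change 1 ≤ cum bad h at this
            linarith
          · have : 1 ≤ 1 / ((K : ℝ) + 1) * (countOff X₀ h : ℝ) := by
              rw [one_div_mul_eq_div, le_div_iff₀ hK1, one_mul]
              exact_mod_cast not_le.1 hcK
            linarith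
    have h2 : ∫ h, E.indicator (fun _ => (1 : ℝ)) h ∂(histLaw M Λ s₀ T) =
        (histLaw M Λ s₀ T).real E := integral_indicator_one hE
    have h3 : Integrable (fun h : Fin T → Obs A => 1 - 1 / ((K : ℝ) + 1) * (countOff X₀ h : ℝ))
        (histLaw M Λ s₀ T) :=
      ((BddMeas.const 1).sub ((bddMeas_countOff X₀ T).const_mul _)).integrable _
    rw [h2, integral_sub h3 ((hbad.cum T).integrable _), integral_sub (integrable_const _)
      (((bddMeas_countOff X₀ T).integrable _).const_mul _), integral_const_mul] at h1
    simp only [integral_const, probReal_univ, one_smul] at h1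
    have h4 : 1 / ((K : ℝ) + 1) * ∫ h, (countOff X₀ h : ℝ) ∂(histLaw M Λ s₀ T) ≤ 1 / 2 := by
      rw [one_div_mul_eq_div, div_le_div_iff₀ hK1 (by norm_num)]
      have := hC T
      linarith
    linarith
  calc (L⁻¹ ^ K).toReal * (1 / 4) ≤ (L⁻¹ ^ K).toReal * (histLaw M Λ s₀ T).real E := by gcongr
    _ = (L⁻¹ ^ K * histLaw M Λ s₀ T E).toReal := (ENNReal.toReal_mul).symm
    _ ≤ _ := ENNReal.toReal_mono (measure_ne_top _ _) hchange

/-! ### Non-optimal pairs are visited infinitely often in expectation -/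

/-- The potential of a history that uses `u` until the `(K + 1)`-st step off `X₀` and `u'` from then
on, with a penalty `D` for each of these first `K + 1` steps. -/
noncomputable def switchPot (M : MDP A) (s₀ : S) (X₀ : Set (Pair A)) (K : ℕ) (D : ℝ)
    (u u' : S → ℝ) {T : ℕ} (h : Fin T → Obs A) : ℝ :=
  avg (stateLaw M s₀ T h) (if countOff X₀ h ≤ K then u else u') -
    D * min (countOff X₀ h : ℝ) (K + 1)

lemma bddMeas_switchPot (M : MDP A) (s₀ : S) (X₀ : Set (Pair A)) (K : ℕ) (D : ℝ)
    (u u' : S → ℝ) (T : ℕ) :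
    BddMeas fun h : Fin T → Obs A => switchPot M s₀ X₀ K D u u' h := by
  have h1 : BddMeas fun h : Fin T → Obs A =>
      avg (stateLaw M s₀ T h) (if countOff X₀ h ≤ K then u else u') := by
    simp only [apply_ite]
    exact BddMeas.ite (measurableSet_countOff_le X₀ T K) (bddMeas_avg_stateLaw M s₀ T u)
      (bddMeas_avg_stateLaw M s₀ T u')
  have h2 : BddMeas fun h : Fin T → Obs A => min (countOff X₀ h : ℝ) (K + 1) :=
    ⟨(bddMeas_countOff X₀ T).1.min measurable_const, K + 1, fun h => by
      rw [abs_of_nonneg (le_min (Nat.cast_nonneg _) (by positivity))]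
      exact min_le_right _ _⟩
  exact h1.sub (h2.const_mul D)

/-- The drift of the switching potential: as long as at most `K` steps off `X₀` have been played,
the agent earns at most `g` per step, as in a model `M` that agrees with `M'` on `X₀`. -/
lemma condStep_switchPot_le {M M' : MDP A} (Λ : Learner A) (s₀ : S) {X₀ : Set (Pair A)}
    (hag : ∀ x ∈ X₀, M'.trans x = M.trans x ∧ M'.rew x = M.rew x) (K : ℕ) {g g' D H H' : ℝ}
    {u u' : S → ℝ} (hu : ∀ x, meanRew M x + avg (M.trans x) u ≤ g + u x.1)
    (hu' : ∀ x, meanRew M' x + avg (M'.trans x) u' ≤ g' + u' x.1)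
    (hH : ∀ s, |u s| ≤ H) (hH' : ∀ s, |u' s| ≤ H') (hD : 1 + 2 * H + H' + |g| ≤ D)
    {T : ℕ} (h : Fin T → Obs A) :
    condStep M' Λ s₀ (fun h' => rewSum h' + switchPot M' s₀ X₀ K D u u' h') h ≤
      (if countOff X₀ h ≤ K then g else g') + (rewSum h + switchPot M' s₀ X₀ K D u u' h) := by
  classical
  let n : Pair A → ℕ := fun x => countOff X₀ h + if x ∈ X₀ then 0 else 1
  rw [condStep_rewSum_add M' Λ s₀ h (k := fun x => avg (M'.trans x) (if n x ≤ K then u else u') -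
    D * min (n x : ℝ) (K + 1)) fun x r => by simp only [switchPot, stateLaw_snoc, countOff_snoc, n]]
  by_cases hK : countOff X₀ h ≤ K
  · have hKr : (countOff X₀ h : ℝ) ≤ K := by exact_mod_cast hK
    have hx : ∀ x, meanRew M' x + (avg (M'.trans x) (if n x ≤ K then u else u') -
        D * min (n x : ℝ) (K + 1)) ≤ (g - D * countOff X₀ h) + u x.1 := fun x => by
      by_cases hx : x ∈ X₀
      · have h1 : n x = countOff X₀ h := by simp [n, hx]
        rw [h1, if_pos hK, min_eq_left (by linarith), (hag x hx).1, meanRew, (hag x hx).2]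
        have := hu x
        rw [meanRew] at this
        linarith
      · have h1 : (n x : ℝ) = countOff X₀ h + 1 := by simp [n, hx]
        rw [h1, min_eq_left (by linarith)]
        have h2 := meanRew_le_one M' x
        have h3 : avg (M'.trans x) (if n x ≤ K then u else u') ≤ H + H' := by
          have hH0 := (abs_nonneg _).trans (hH x.1)
          have hH0' := (abs_nonneg _).trans (hH' x.1)
          split_ifs
          · have := (abs_le.1 (abs_avg_le (M'.trans x) hH)).2
            linarith
          · have := (abs_le.1 (abs_avg_le (M'.trans x) hH')).2
            linarith
        have h4 := (abs_le.1 (hH x.1)).1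
        have h5 := neg_abs_le g
        linarith
    have h1 := stepAvg_mono_of_weight M' Λ s₀ h fun x _ => hx x
    rw [stepAvg_add _ _ _ _ (fun _ => g - D * countOff X₀ h), stepAvg_const, stepAvg_state] at h1
    rw [if_pos hK, switchPot, if_pos hK, min_eq_left (by linarith)]
    linarith
  · have hKr : (K : ℝ) + 1 ≤ countOff X₀ h := by exact_mod_cast not_le.1 hK
    have hx : ∀ x, meanRew M' x + (avg (M'.trans x) (if n x ≤ K then u else u') -
        D * min (n x : ℝ) (K + 1)) ≤ (g' - D * (K + 1)) + u' x.1 := fun x => by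
      have h1 : countOff X₀ h ≤ n x := Nat.le_add_right _ _
      have h2 : (countOff X₀ h : ℝ) ≤ n x := by exact_mod_cast h1
      rw [if_neg (fun h3 => hK (h1.trans h3)), min_eq_right (by linarith)]
      have := hu' x
      linarith
    have h1 := stepAvg_mono_of_weight M' Λ s₀ h fun x _ => hx x
    rw [stepAvg_add _ _ _ _ (fun _ => g' - D * (K + 1)), stepAvg_const, stepAvg_state] at h1
    rw [if_neg hK, switchPot, if_neg hK, min_eq_right hKr]
    linarith

/-- An agent that plays at most `K` steps off `X₀` with a probability at least `δ` earns less than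
`g'` by at least `(g' - g) * δ` per step, up to a constant. -/
lemma exists_expReward_le_of_prob {M M' : MDP A} (Λ : Learner A) (s₀ : S) {X₀ : Set (Pair A)}
    (hag : ∀ x ∈ X₀, M'.trans x = M.trans x ∧ M'.rew x = M.rew x) {K : ℕ} {g g' δ : ℝ}
    {u u' : S → ℝ} (hu : ∀ x, meanRew M x + avg (M.trans x) u ≤ g + u x.1)
    (hu' : ∀ x, meanRew M' x + avg (M'.trans x) u' ≤ g' + u' x.1) (hg : g ≤ g')
    (hδ : ∀ T, δ ≤ (histLaw M' Λ s₀ T).real {h | countOff X₀ h ≤ K}) :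
    ∃ C, ∀ T : ℕ, expReward M' Λ s₀ T ≤ (g' - (g' - g) * δ) * T + C := by
  obtain ⟨H, hH0, hH⟩ := exists_abs_le u
  obtain ⟨H', hH0', hH'⟩ := exists_abs_le u'
  let D : ℝ := 1 + 2 * H + H' + |g|
  have hD0 : 0 ≤ D := by positivity
  let F : ∀ T, (Fin T → Obs A) → ℝ := fun T h => rewSum h + switchPot M' s₀ X₀ K D u u' h
  have hF : ∀ T, BddMeas (F T) := fun T =>
    (bddMeas_rewSum T).add (bddMeas_switchPot M' s₀ X₀ K D u u' T)
  have key : ∀ T : ℕ, ∫ h, F T h ∂(histLaw M' Λ s₀ T) ≤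
      (g' - (g' - g) * δ) * T + ∫ h, F 0 h ∂(histLaw M' Λ s₀ 0) := by
    intro T
    induction T with
    | zero => simp
    | succ T ih =>
      have hm := measurableSet_countOff_le (A := A) X₀ T K
      have hite : ∀ h : Fin T → Obs A, (if countOff X₀ h ≤ K then g else g') =
          g' - {h : Fin T → Obs A | countOff X₀ h ≤ K}.indicator (fun _ => g' - g) h := fun h => by
        by_cases hK : countOff X₀ h ≤ K <;> simp [hK]
      have hb : BddMeas fun h : Fin T → Obs A => if countOff X₀ h ≤ K then g else g' :=
        BddMeas.ite hm (BddMeas.const g) (BddMeas.const g')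
      have hstep := integral_histLaw_succ_le M' Λ s₀ T (hF (T + 1)) (hb.add (hF T))
        (condStep_switchPot_le Λ s₀ hag K hu hu' hH hH' le_rfl)
      rw [integral_add (hb.integrable _) ((hF T).integrable _)] at hstep
      have h1 : ∫ h : Fin T → Obs A, (if countOff X₀ h ≤ K then g else g') ∂(histLaw M' Λ s₀ T) ≤
          g' - (g' - g) * δ := by
        simp only [hite]
        rw [integral_sub (integrable_const _) ((integrable_const _).indicator hm),
          integral_indicator_const _ hm]
        simp only [integral_const, probReal_univ, smul_eq_mul, one_mul]
        have := mul_le_mul_of_nonneg_left (hδ T) (sub_nonneg.2 hg)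
        linarith
      push_cast
      linarith
  refine ⟨∫ h, F 0 h ∂(histLaw M' Λ s₀ 0) + (H + H' + D * (K + 1)), fun T => ?_⟩
  have h1 : ∫ h, (rewSum h - (H + H' + D * (K + 1))) ∂(histLaw M' Λ s₀ T) ≤
      ∫ h, F T h ∂(histLaw M' Λ s₀ T) := by
    refine integral_mono (((bddMeas_rewSum T).sub (BddMeas.const _)).integrable _)
      ((hF T).integrable _) fun h => ?_
    have h2 : -(H + H') ≤ avg (stateLaw M' s₀ T h) (if countOff X₀ h ≤ K then u else u') := by
      split_ifs
      · have := (abs_le.1 (abs_avg_le (stateLaw M' s₀ T h) hH)).1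
        linarith
      · have := (abs_le.1 (abs_avg_le (stateLaw M' s₀ T h) hH')).1
        linarith
    have h3 : D * min (countOff X₀ h : ℝ) (K + 1) ≤ D * (K + 1) :=
      mul_le_mul_of_nonneg_left (min_le_right _ _) hD0
    simp only [F, switchPot]
    linarith
  rw [integral_sub ((bddMeas_rewSum T).integrable _) (integrable_const _), ← expReward_eq] at h1
  simp only [integral_const, probReal_univ, one_smul] at h1
  have := key T
  linarith

/-- Consistency forces the expected number of steps at non-optimal pairs to be unbounded: otherwise
the agent would play optimal pairs of `M` almost all the time, with positive probability, in a
confusing model where this costs a linear regret. -/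
lemma not_bddAbove_expNonOptVisits [∀ s, Nonempty (A s)] {𝓜 : Set (MDP A)} {Λ : Learner A}
    (hΛ : Consistent 𝓜 Λ) {M : MDP A} (hcomm : Communicating M) (hconf : (confusing 𝓜 M).Nonempty)
    (s₀ : S) : ¬ BddAbove (Set.range (expNonOptVisits M Λ s₀)) := by
  rintro ⟨C, hC⟩
  obtain ⟨M', hM'⟩ := hconf
  obtain ⟨hM'𝓜, hd, hag, -⟩ := id hM'
  obtain ⟨g, u, f, hu, hf⟩ := exists_bellman M hcomm s₀
  obtain ⟨g', u', f', hu', hf'⟩ :=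
    exists_bellman M' (fun s s' => (hcomm s s').of_dominates hd) s₀
  have hlt := gain_lt_of_confusing hM' hu hf hu'
  have hopt := (optGain_eq_of_bellman M' hu' hf').1
  obtain ⟨K, δ, hδ0, hδ⟩ := exists_prob_countOff_le hd (optPairs M) hag Λ s₀ (C := C) fun T => by
    rw [← expNonOptVisits_eq]
    exact hC ⟨T, rfl⟩
  obtain ⟨C', hC'⟩ := exists_expReward_le_of_prob Λ s₀ hag hu hu' hlt.le hδ
  have hc : 0 < (g' - g) * δ := mul_pos (sub_pos.2 hlt) hδ0
  -- The regret in `M'` is at least `c * T - C'`, which contradicts consistency for `η = 1`.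
  have ho := hΛ M' hM'𝓜 s₀ 1 one_pos
  simp only [Real.rpow_one] at ho
  have hev := ho.bound (half_pos hc)
  obtain ⟨T, hT, hT'⟩ := (hev.and ((tendsto_natCast_atTop_atTop (R := ℝ)).eventually_gt_atTop
    (C' / ((g' - g) * δ / 2)))).exists
  rw [div_lt_iff₀ (half_pos hc)] at hT'
  have h1 := (le_abs_self _).trans hT
  rw [Real.norm_of_nonneg T.cast_nonneg, regret, hopt] at h1
  have h2 := hC' T
  nlinarith

lemma tendsto_expNonOptVisits [∀ s, Nonempty (A s)] {𝓜 : Set (MDP A)} {Λ : Learner A}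
    (hΛ : Consistent 𝓜 Λ) {M : MDP A} (hcomm : Communicating M) (hconf : (confusing 𝓜 M).Nonempty)
    (s₀ : S) : Tendsto (expNonOptVisits M Λ s₀) atTop atTop := by
  classical
  refine tendsto_atTop_atTop_of_monotone' (monotone_nat_of_le_succ fun T => ?_)
    (not_bddAbove_expNonOptVisits hΛ hcomm hconf s₀)
  let f : Obs A → ℝ := fun o => if o.1 ∈ optPairs M then 0 else 1
  have hf : BddMeas f := bddMeas_pair fun x => if x ∈ optPairs M then 0 else 1
  obtain ⟨hi, he⟩ := integral_histLaw_succ M Λ s₀ T (hf.cum (T + 1))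
  simp only [expNonOptVisits_eq, cast_countOff]
  rw [he]
  refine integral_mono ((hf.cum T).integrable _) hi fun h => ?_
  have h1 := condStep_cum_add M Λ s₀ h hf (ψ := fun _ => 0) (k := fun _ => 0) fun _ _ => rfl
  simp only [add_zero] at h1
  rw [h1]
  refine le_add_of_nonneg_right (Finset.sum_nonneg fun x _ =>
    mul_nonneg ENNReal.toReal_nonneg (integral_nonneg fun r => ?_))
  simp only [f, Pi.zero_apply]
  split_ifs <;> norm_num

/-! ### Conservation of flow -/

/-- The visits that leave a set of states, described by its indicator `w`, balance those that enter
it, up to the initial and the current state. -/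
lemma abs_sum_visits_sub_le (M : MDP A) (Λ : Learner A) (s₀ : S) {w : S → ℝ}
    (hw0 : ∀ s, 0 ≤ w s) (hw1 : ∀ s, w s ≤ 1) (T : ℕ) :
    |∑ x, (w x.1 - avg (M.trans x) w) * ∫ h, (visits h x : ℝ) ∂(histLaw M Λ s₀ T)| ≤ 1 := by
  let f : Obs A → ℝ := fun o => w o.1.1 - avg (M.trans o.1) w
  have hf : BddMeas f := bddMeas_pair fun x => w x.1 - avg (M.trans x) w
  have hst := bddMeas_avg_stateLaw (A := A) M s₀
  have key : ∀ T : ℕ, ∫ h, (cum f h + avg (stateLaw M s₀ T h) w) ∂(histLaw M Λ s₀ T) = w s₀ := by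
    intro T
    induction T with
    | zero => rw [integral_histLaw_zero]; simp [stateLaw, avg_pure]
    | succ T ih =>
      rw [(integral_histLaw_succ M Λ s₀ T ((hf.cum (T + 1)).add (hst (T + 1) w))).2, ← ih]
      refine integral_congr_ae (ae_of_all _ fun h => ?_)
      simp only
      rw [condStep_cum_add M Λ s₀ h hf (k := fun x => avg (M.trans x) w)
        fun x r => by rw [stateLaw_snoc]]
      simp [f, stepAvg_state]
  have h1 : ∑ x, (w x.1 - avg (M.trans x) w) * ∫ h, (visits h x : ℝ) ∂(histLaw M Λ s₀ T) =
      ∫ h, cum f h ∂(histLaw M Λ s₀ T) := by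
    simp only [← integral_const_mul]
    rw [← integral_finsetSum _ fun x _ => ((bddMeas_visits T x).integrable _).const_mul _]
    exact integral_congr_ae (ae_of_all _ fun h =>
      sum_mul_visits h fun x => w x.1 - avg (M.trans x) w)
  have h2 := key T
  rw [integral_add ((hf.cum T).integrable _) ((hst T w).integrable _)] at h2
  have havg : ∀ h : Fin T → Obs A, avg (stateLaw M s₀ T h) w ∈ Set.Icc (0 : ℝ) 1 := fun h =>
    ⟨by simpa using avg_mono (stateLaw M s₀ T h) hw0, by simpa using avg_mono _ hw1⟩
  have h3 : 0 ≤ ∫ h, avg (stateLaw M s₀ T h) w ∂(histLaw M Λ s₀ T) :=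
    integral_nonneg fun h => (havg h).1
  have h4 : ∫ h, avg (stateLaw M s₀ T h) w ∂(histLaw M Λ s₀ T) ≤ 1 := by
    simpa using integral_mono ((hst T w).integrable (histLaw M Λ s₀ T)) (integrable_const 1)
      fun h => (havg h).2
  rw [h1, abs_le]
  have h5 := hw0 s₀
  have h6 := hw1 s₀
  constructor <;> linarith

/-- An optimal pair stays within its communicating component of optimal pairs. -/
lemma cmk_eq_of_mem_optPairs {M : MDP A} {x : Pair A} (hx : x ∈ optPairs M) {s : S}
    (hs : M.trans x s ≠ 0) : cmk M (optPairs M) s = cmk M (optPairs M) x.1 := by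
  obtain ⟨π, hπ, hxs, hrec⟩ := Set.mem_iUnion₂.1 hx
  have hstep : Reaches M π.support x.1 s := .single ⟨x, hxs, rfl, hs⟩
  -- All pairs played on the way back from `s` are recurrent themselves.
  have hback : ∀ t, Reaches M π.support x.1 t → Reaches M π.support t x.1 →
      Reaches M (optPairs M) t x.1 := by
    intro t ht h
    induction h using Relation.ReflTransGen.head_induction_on with
    | refl => exact Relation.ReflTransGen.refl
    | head h h' ih =>
      obtain ⟨y, hy, rfl, hp⟩ := h
      refine Relation.ReflTransGen.head ⟨y, ?_, rfl, hp⟩ (ih (ht.tail ⟨y, hy, rfl, hp⟩))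
      exact Set.mem_biUnion hπ ⟨hy, fun t hyt => (hrec t (ht.trans hyt)).trans ht⟩
  exact Quotient.sound ⟨hback s hstep (hrec s hstep), .single ⟨x, hx, rfl, hs⟩⟩

/-! ### The normalized visit vector -/

/-- The defect of `μ` in the equation of the invariant measures at the merged state `c`. -/
noncomputable def flowDefect (M : MDP A) (X₀ : Set (Pair A)) (c : CState M X₀)
    (μ : Pair A → ℝ) : ℝ :=
  ∑ x, ({s | cmk M X₀ s = c}.indicator 1 x.1 -
    avg (M.trans x) ({s | cmk M X₀ s = c}.indicator 1)) * μ x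

lemma continuous_flowDefect (M : MDP A) (X₀ : Set (Pair A)) (c : CState M X₀) :
    Continuous (flowDefect M X₀ c) :=
  continuous_finsetSum _ fun x _ => continuous_const.mul (continuous_apply x)

lemma avg_indicator_eq_map (M : MDP A) (X₀ : Set (Pair A)) (c : CState M X₀) (x : Pair A) :
    avg (M.trans x) ({s | cmk M X₀ s = c}.indicator 1) =
      ((M.trans x).map (cmk M X₀) c).toReal := by
  classical
  rw [PMF.map_apply, tsum_fintype, ENNReal.toReal_sum, avg]
  · refine Finset.sum_congr rfl fun s _ => ?_
    by_cases hs : cmk M X₀ s = c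
    · simp [hs]
    · simp [hs, Ne.symm hs]
  · intro s _
    split_ifs
    · exact PMF.apply_ne_top _ _
    · exact ENNReal.zero_ne_top

lemma mem_contractedInvariantProbs_iff (M : MDP A) (X₀ : Set (Pair A)) (μ : Pair A → ℝ) :
    μ ∈ contractedInvariantProbs M X₀ ↔
      μ ∈ stdSimplex ℝ (Pair A) ∧ ∀ c, flowDefect M X₀ c μ = 0 := by
  classical
  have h1 : ∀ c, ∑ y : Pair (CAct M X₀) with y.1 = c, μ ((pairEquiv M X₀).symm y) =
      ∑ x, {s | cmk M X₀ s = c}.indicator 1 x.1 * μ x := fun c => by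
    rw [Finset.sum_filter]
    refine (Fintype.sum_equiv (pairEquiv M X₀) _ _ fun x => ?_).symm
    rw [Equiv.symm_apply_apply]
    by_cases hx : cmk M X₀ x.1 = c
    · have : ((pairEquiv M X₀) x).1 = c := hx
      simp [hx, this]
    · have : ¬ ((pairEquiv M X₀) x).1 = c := hx
      simp [hx, this]
  have h2 : ∀ c, ∑ y : Pair (CAct M X₀), μ ((pairEquiv M X₀).symm y) *
      ((contraction M X₀).trans y c).toReal =
      ∑ x, avg (M.trans x) ({s | cmk M X₀ s = c}.indicator 1) * μ x := fun c => by
    refine (Fintype.sum_equiv (pairEquiv M X₀) _ _ fun x => ?_).symm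
    rw [avg_indicator_eq_map, contraction]
    simp only [Equiv.symm_apply_apply]
    ring
  have h3 : ∀ c, flowDefect M X₀ c μ = 0 ↔
      ∑ y : Pair (CAct M X₀) with y.1 = c, μ ((pairEquiv M X₀).symm y) =
        ∑ y : Pair (CAct M X₀), μ ((pairEquiv M X₀).symm y) *
          ((contraction M X₀).trans y c).toReal := fun c => by
    rw [h1, h2, flowDefect]
    simp only [sub_mul, Finset.sum_sub_distrib]
    exact sub_eq_zero
  constructor
  · rintro ⟨⟨-, h⟩, hμ⟩
    refine ⟨hμ, fun c => (h3 c).2 ?_⟩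
    convert h c
  · rintro ⟨hμ, h⟩
    refine ⟨⟨fun y => hμ.1 _, fun c => ?_⟩, hμ⟩
    convert (h3 c).1 (h c)

lemma navVector_eq (M : MDP A) (Λ : Learner A) (s₀ : S) (T : ℕ) (x : Pair A)
    [Decidable (x ∈ optPairs M)] :
    navVector M Λ s₀ T x = (if x ∈ optPairs M then 0 else
      ∫ h, (visits h x : ℝ) ∂(histLaw M Λ s₀ T)) / expNonOptVisits M Λ s₀ T := by
  rw [navVector]
  by_cases hx : x ∈ optPairs M <;> simp [hx]

lemma navVector_mem_stdSimplex (M : MDP A) (Λ : Learner A) (s₀ : S) {T : ℕ}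
    (hT : 0 < expNonOptVisits M Λ s₀ T) : navVector M Λ s₀ T ∈ stdSimplex ℝ (Pair A) := by
  classical
  have h0 : ∀ x, 0 ≤ ∫ h, (visits h x : ℝ) ∂(histLaw M Λ s₀ T) := fun x =>
    integral_nonneg fun h => Nat.cast_nonneg _
  refine ⟨fun x => ?_, ?_⟩
  · rw [navVector_eq]
    refine div_nonneg ?_ hT.le
    split_ifs
    · exact le_rfl
    · exact h0 x
  · simp only [navVector_eq]
    rw [← Finset.sum_div, div_eq_one_iff_eq hT.ne', expNonOptVisits,
      integral_finsetSum _ fun x _ => (bddMeas_visits T x).integrable _, Finset.sum_filter]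
    refine Finset.sum_congr (by congr!) fun x _ => ?_
    by_cases hx : x ∈ optPairs M <;> simp [hx]

/-- Optimal pairs do not contribute to the flow between merged states, so the visits of non-optimal
pairs alone are balanced up to a constant. -/
lemma abs_flowDefect_navVector_le (M : MDP A) (Λ : Learner A) (s₀ : S) (T : ℕ)
    (hT : 0 < expNonOptVisits M Λ s₀ T) (c : CState M (optPairs M)) :
    |flowDefect M (optPairs M) c (navVector M Λ s₀ T)| ≤ 1 / expNonOptVisits M Λ s₀ T := by
  classical
  let w : S → ℝ := {s | cmk M (optPairs M) s = c}.indicator 1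
  have hw0 : ∀ s, 0 ≤ w s := fun s => Set.indicator_nonneg (fun _ _ => zero_le_one) s
  have hw1 : ∀ s, w s ≤ 1 := fun s => Set.indicator_le_self' (fun _ _ => zero_le_one) s
  have hopt : ∀ x ∈ optPairs M, w x.1 - avg (M.trans x) w = 0 := fun x hx => by
    have hws : ∀ s, M.trans x s ≠ 0 → w s = w x.1 := fun s hs => by
      simp only [w, Set.indicator_apply, Set.mem_ofPred_eq, cmk_eq_of_mem_optPairs hx hs,
        Pi.one_apply]
    have h1 := avg_mono_of_support (M.trans x) (w := fun _ => w x.1) fun s hs => (hws s hs).le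
    have h2 := avg_mono_of_support (M.trans x) (u := fun _ => w x.1) fun s hs => (hws s hs).ge
    rw [avg_const] at h1 h2
    linarith
  have h1 : flowDefect M (optPairs M) c (navVector M Λ s₀ T) =
      (∑ x, (w x.1 - avg (M.trans x) w) * ∫ h, (visits h x : ℝ) ∂(histLaw M Λ s₀ T)) /
        expNonOptVisits M Λ s₀ T := by
    rw [flowDefect, Finset.sum_div]
    refine Finset.sum_congr rfl fun x _ => ?_
    rw [navVector_eq]
    by_cases hx : x ∈ optPairs M
    · rw [hopt x hx]; simp [hx]
    · simp only [hx, if_false, w, mul_div_assoc]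
  rw [h1, abs_div, abs_of_pos hT]
  gcongr
  exact abs_sum_visits_sub_le M Λ s₀ hw0 hw1 T

end NavMDP

theorem mainTheorem7 {S : Type*} [Fintype S] {A : S → Type*} [∀ s, Fintype (A s)]
    [∀ s, Nonempty (A s)] (𝓜 : Set (NavMDP.MDP A)) (Λ : NavMDP.Learner A)
    (hΛ : NavMDP.Consistent 𝓜 Λ) (M : NavMDP.MDP A) (hM : M ∈ 𝓜)
    (hcomm : NavMDP.Communicating M) (hconf : (NavMDP.confusing 𝓜 M).Nonempty) (s₀ : S) :
    (∀ᶠ T in atTop, 0 < NavMDP.expNonOptVisits M Λ s₀ T) ∧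
    (NavMDP.contractedInvariantProbs M (NavMDP.optPairs M)).Nonempty ∧
    Tendsto (fun T => Metric.infDist (NavMDP.navVector M Λ s₀ T)
      (NavMDP.contractedInvariantProbs M (NavMDP.optPairs M))) atTop (𝓝 0) ∧
    ∀ ν, MapClusterPt ν atTop (NavMDP.navVector M Λ s₀) →
      ν ∈ NavMDP.contractedInvariantProbs M (NavMDP.optPairs M) := by
  have htop := NavMDP.tendsto_expNonOptVisits hΛ hcomm hconf s₀
  have hpos := htop.eventually_gt_atTop 0
  have hsimp : ∀ᶠ T in atTop, NavMDP.navVector M Λ s₀ T ∈ stdSimplex ℝ (NavMDP.Pair A) :=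
    hpos.mono fun T hT => NavMDP.navVector_mem_stdSimplex M Λ s₀ hT
  have hdef : ∀ c, Tendsto (fun T => NavMDP.flowDefect M (NavMDP.optPairs M) c
      (NavMDP.navVector M Λ s₀ T)) atTop (𝓝 0) := fun c =>
    squeeze_zero_norm' (hpos.mono fun T hT =>
      NavMDP.abs_flowDefect_navVector_le M Λ s₀ T hT c) (tendsto_const_nhds.div_atTop htop)
  have hclust : ∀ ν, MapClusterPt ν atTop (NavMDP.navVector M Λ s₀) →
      ν ∈ NavMDP.contractedInvariantProbs M (NavMDP.optPairs M) := fun ν hν => by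
    refine (NavMDP.mem_contractedInvariantProbs_iff M _ ν).2 ⟨?_, fun c => ?_⟩
    · exact (isClosed_stdSimplex ℝ (NavMDP.Pair A)).mem_of_mapClusterPt hν hsimp
    · obtain ⟨φ, hφ, hlim⟩ := hν.tendsto_subseq
      exact tendsto_nhds_unique
        (((NavMDP.continuous_flowDefect M (NavMDP.optPairs M) c).tendsto ν).comp hlim)
        ((hdef c).comp hφ.tendsto_atTop)
  have hcpt := isCompact_stdSimplex ℝ (NavMDP.Pair A)
  refine ⟨hpos, ?_, ?_, hclust⟩
  · obtain ⟨ν, -, hν⟩ := hcpt.exists_mapClusterPt (tendsto_principal.2 hsimp)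
    exact ⟨ν, hclust ν hν⟩
  · have hset := hcpt.tendsto_nhdsSet_of_mapClusterPt hsimp fun ν _ hν => hclust ν hν
    refine Metric.tendsto_nhds.2 fun ε hε => ?_
    have hU : {μ | Metric.infDist μ (NavMDP.contractedInvariantProbs M (NavMDP.optPairs M)) < ε} ∈
        𝓝ˢ (NavMDP.contractedInvariantProbs M (NavMDP.optPairs M)) :=
      (isOpen_lt (Metric.continuous_infDist_pt _) continuous_const).mem_nhdsSet.2 fun μ hμ => by
        simpa [Metric.infDist_zero_of_mem hμ] using hε
    filter_upwards [hset hU] with T hT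
    rw [Real.dist_0_eq_abs, abs_of_nonneg Metric.infDist_nonneg]
    exact hT
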